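/- Let $N\ge 1$. Let $M_N$ be the space of complex $N\times N$ matrices and let $S_2^N$ be $M_N$ with the Hilbert–Schmidt norm. For $x,y\in M_N$, view $x\otimes\bar y$ as the operator $\xi\mapsto x\xi y^*$ on $S_2^N$ (equivalently, as the Kronecker product of $x$ with the entrywise conjugate of $y$, acting on $\ell_2^N\otimes\overline{\ell_2^N}$). Let $P$ be the orthogonal projection of $S_2^N$ onto the line $\mathbb C I$ spanned by the identity matrix. For an operator $x$ on a finite-dimensional Hilbert space let $\|x\|_q=(\mathrm{tr}\,|x|^q)^{1/q}$ for $1\le q<\infty$, and let $\|x\|_\infty$ be the operator norm. There is an absolute constant $C$ such that the following holds for all integers $N,n\ge 1$, all real $p\ge 1$ and all $1\le q\le\infty$. Let $U_1,\dots,U_n$ be independent random matrices distributed according to the normalized Haar measure on the unitary group $U(N)$. Let $Y_1,\dots,Y_n$ be independent random $N\times N$ matrices, each having the law of the matrix with entries $(2N)^{-1/2}(g_{ij}+\sqrt{-1}\,g'_{ij})$, where all $g_{ij},g'_{ij}$ are independent real $N(0,1)$ variables, and let $(Y'_j)_{j\le n}$ be an independent copy of $(Y_j)_{j\le n}$. Then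 for all scalars $a_1,\dots,a_n\in\mathbb C$, $$\mathbb E\Big\|\sum_{j=1}^n a_j\,U_j\otimes\bar U_j\,(I-P)\Big\|_q^p\le C^p\,\mathbb E\Big\|\sum_{j=1}^n a_j\,Y_j\otimes\bar Y'_j\Big\|_q^p ,$$ and, with the same constant $C$, for every $k\ge 1$ and all matrices $a_1,\dots,a_n\in M_k$, $$\mathbb E\Big\|\sum_{j=1}^n a_j\otimes\big(U_j\otimes\bar U_j\,(I-P)\big)\Big\|_q^p\le C^p\,\mathbb E\Big\|\sum_{j=1}^n a_j\otimes Y_j\otimes\bar Y'_j\Big\|_q^p .$$ -/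

import Mathlib

open MeasureTheory ProbabilityTheory
open scoped Matrix Kronecker ENNReal NNReal

/-- Matrices carry the product (equivalently, Borel) σ-algebra. -/
noncomputable instance Matrix.measurableSpaceComplex {m n : Type*} :
    MeasurableSpace (Matrix m n ℂ) :=
  inferInstanceAs (MeasurableSpace (m → n → ℂ))

instance Matrix.borelSpaceComplex {m n : Type*} [Finite m] [Finite n] :
    BorelSpace (Matrix m n ℂ) :=
  inferInstanceAs (BorelSpace (m → n → ℂ))

instance Matrix.compactSpaceUnitaryGroup {n : Type*} [Fintype n] [DecidableEq n] :
    CompactSpace (Matrix.unitaryGroup n ℂ) := by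
  apply isCompact_iff_compactSpace.mp
  have hK : IsCompact (Set.univ.pi fun _ : n => Set.univ.pi fun _ : n =>
      Metric.closedBall (0 : ℂ) 1) :=
    isCompact_univ_pi fun _ => isCompact_univ_pi fun _ => isCompact_closedBall 0 1
  refine IsCompact.of_isClosed_subset (s := (Set.univ.pi fun _ : n => Set.univ.pi fun _ : n =>
      Metric.closedBall (0 : ℂ) 1 : Set (Matrix n n ℂ))) hK ?_ ?_
  · have h : ((Matrix.unitaryGroup n ℂ : Submonoid (Matrix n n ℂ)) : Set (Matrix n n ℂ)) =
        {A | A * star A = 1} := by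
      ext A
      exact Matrix.mem_unitaryGroup_iff
    rw [h]
    exact isClosed_eq (by fun_prop) continuous_const
  · intro A hA i _ j _
    simpa using entry_norm_bound_of_unitary hA i j

noncomputable section

namespace RandomTensor

/-- The Schatten `q`-norm of a square complex matrix: `(tr (|A| ^ q)) ^ (1 / q)` for `q < ∞`,
where `|A| = (A* A) ^ (1 / 2)`, and the operator norm on the Euclidean space for `q = ∞`. -/
def schattenNorm {m : Type*} [Fintype m] [DecidableEq m] (q : ℝ≥0∞) (A : Matrix m m ℂ) : ℝ :=
  open scoped MatrixOrder in
  if q = ∞ then ‖Matrix.toEuclideanCLM (n := m) (𝕜 := ℂ) A‖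
  else (Matrix.trace (CFC.abs A ^ q.toReal)).re ^ (1 / q.toReal)

/-- A matrix `ξ ∈ M_N` as a vector of `ℓ₂ ⊗ ℓ₂` with entries `ξ i j`. The Euclidean norm is the
Hilbert–Schmidt norm, so this identifies `S_2^N` with `EuclideanSpace ℂ (Fin N × Fin N)`. -/
def hsVec {N : ℕ} (ξ : Matrix (Fin N) (Fin N) ℂ) : EuclideanSpace ℂ (Fin N × Fin N) :=
  WithLp.toLp 2 fun i => ξ i.1 i.2

/-- The tensor `x ⊗ ȳ`, where `ȳ` is the entrywise complex conjugate of `y`. -/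
def tensorBar {N : ℕ} (x y : Matrix (Fin N) (Fin N) ℂ) :
    Matrix (Fin N × Fin N) (Fin N × Fin N) ℂ :=
  x ⊗ₖ y.map (starRingEnd ℂ)

/-- On `S_2^N` the tensor `x ⊗ ȳ` acts as `ξ ↦ x ξ y*`. -/
theorem tensorBar_apply {N : ℕ} (x y ξ : Matrix (Fin N) (Fin N) ℂ) :
    Matrix.toEuclideanCLM (n := Fin N × Fin N) (𝕜 := ℂ) (tensorBar x y) (hsVec ξ) =
      hsVec (x * ξ * yᴴ) := by
  ext ⟨i, j⟩
  simp only [hsVec, tensorBar, Matrix.toEuclideanCLM_toLp, Matrix.mulVec, dotProduct,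
    Matrix.kroneckerMap_apply, Matrix.map_apply, Matrix.mul_apply, Matrix.conjTranspose_apply,
    Fintype.sum_prod_type, Finset.sum_mul]
  rw [Finset.sum_comm]
  refine Finset.sum_congr rfl fun k _ => Finset.sum_congr rfl fun l _ => ?_
  simp only [starRingEnd_apply]
  ring

/-- The matrix of the orthogonal projection of `S_2^N` onto the line `ℂ I` spanned by the identity
matrix. -/
def projId (N : ℕ) : Matrix (Fin N × Fin N) (Fin N × Fin N) ℂ :=
  (Matrix.toEuclideanCLM (n := Fin N × Fin N) (𝕜 := ℂ)).symm
    (Submodule.span ℂ {hsVec (1 : Matrix (Fin N) (Fin N) ℂ)}).starProjection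

/-- The normalized Haar measure of the unitary group `U(N)`. -/
def haarUnitary (N : ℕ) : Measure (Matrix.unitaryGroup (Fin N) ℂ) :=
  Measure.haarMeasure ⊤

/-- The law of the normalized complex Gaussian `N × N` matrix, with entries
`(2N)^{-1/2} (g i j + √-1 g' i j)` where all `g i j`, `g' i j` are independent real standard
normal variables. -/
def gaussianMatrix (N : ℕ) : Measure (Matrix (Fin N) (Fin N) ℂ) :=
  (Measure.pi fun _ : Fin N × Fin N => (gaussianReal 0 1).prod (gaussianReal 0 1)).map
    fun g => Matrix.of fun i j =>
      (((Real.sqrt (2 * N))⁻¹ : ℝ) : ℂ) * ((g (i, j)).1 + (g (i, j)).2 * Complex.I)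

end RandomTensor

end

namespace RandomTensor

/-! ### Schatten norms: singular values, variational formula, contraction under projections -/

section Schatten

open scoped MatrixOrder ComplexOrder

variable {m : Type*} [Fintype m] [DecidableEq m]

/-! Let `U` be Haar and `Y` Gaussian, independent. By polar decomposition and unitary invariance of
both laws, `U|Y|` has the law of `Y`. Averaging over `Y` alone, `𝔼 (U|Y| ⊗ conj (U|Y|)) (I - P) = (U
⊗ Ū) 𝔼(|Y| ⊗ conj |Y|) (I - P)`. The map `ξ ↦ 𝔼 |Y| ξ |Y|` commutes with unitary conjugation, so on
the range of `I - P`, the matrices of trace zero, it is a scalar `c`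
(`exists_eq_smul_of_conj_equivariant`). Thus `c (U ⊗ Ū)(I - P)` is a conditional expectation of a
copy of `(Y ⊗ Ȳ)(I - P)`, and Jensen's inequality bounds the unitary moments by the Gaussian ones at
the cost of `|c|⁻ᵖ`.

The scalar is found by a trace computation, `c (N² - 1) + 1 = 𝔼 (tr |Y|)²`. Second and fourth
moments of `Y` bound the right side below, which gives `|c| ≥ 1/12` for all `N`
(`exists_averageConj_cfcAbs_eq_smul`).

It remains to decouple. Since `𝔼 (Y ⊗ Ȳ)(I - P) = 0`, Jensen allows subtracting an independent copy.
The rotation `(Y, Y') ↦ ((Y + Y')/√2, (Y - Y')/√2)` preserves the joint law and turns `Y ⊗ Ȳ - Y' ⊗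
Ȳ'` into `Y ⊗ Ȳ' + Y' ⊗ Ȳ`. The two terms have equal moments after exchanging the copies, and `I -
P` is a contraction on the right, so this costs `2ᵖ`. Altogether `C = 12 · 2`.

The argument uses only a seminorm `Ψ` on `n`-tuples of operators that does not grow under right
multiplication by `I - P` (`lintegral_haar_le_gaussian`). Scalar and matrix coefficients are two
choices of `Ψ`. Moments are integrals in `[0, ∞]`, so no finiteness has to be established for the
comparison. -/

theorem exists_unitary_mul_diagonal_of_conjTranspose_mul_self (M : Matrix m m ℂ) (s : m → ℝ)
    (h : Mᴴ * M = Matrix.diagonal fun i => ((s i ^ 2 : ℝ) : ℂ)) :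
    ∃ W ∈ Matrix.unitaryGroup m ℂ, M = W * Matrix.diagonal fun i => (s i : ℂ) := by
  classical
  have hin : ∀ i j, (∑ k, star (M k i) * M k j) = if i = j then ((s i ^ 2 : ℝ) : ℂ) else 0 := by
    intro i j
    have := congrFun (congrFun h i) j
    simpa [Matrix.mul_apply, Matrix.diagonal_apply] using this
  let v : m → EuclideanSpace ℂ m := fun i => WithLp.toLp 2 fun k => (s i : ℂ)⁻¹ * M k i
  -- Only the columns with `s i ≠ 0` can be normalized. The remaining columns of `M` vanish, so any
  -- completion to an orthonormal basis serves as `W`.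
  have hv : Orthonormal ℂ (({i | s i ≠ 0} : Set m).domRestrict v) := by
    rw [orthonormal_iff_ite]
    rintro ⟨i, hi⟩ ⟨j, hj⟩
    have hi' : (s i : ℂ) ≠ 0 := by exact_mod_cast hi
    have : inner ℂ (v i) (v j) = (s i : ℂ)⁻¹ * (s j : ℂ)⁻¹ * ∑ k, star (M k i) * M k j := by
      simp only [v, PiLp.inner_apply, Finset.mul_sum, RCLike.inner_apply, map_mul, map_inv₀,
        Complex.conj_ofReal]
      refine Finset.sum_congr rfl fun k _ => ?_
      simp only [starRingEnd_apply]
      ring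
    change inner ℂ (v i) (v j) = _
    rw [this, hin]
    simp only [Subtype.mk.injEq]
    split_ifs with hij
    · subst hij
      push_cast
      field_simp
    · simp
  obtain ⟨b, hb⟩ := hv.exists_orthonormalBasis_extension_of_card_eq (by simp)
  refine ⟨Matrix.of fun k i => b i k, ?_, ?_⟩
  · rw [Matrix.mem_unitaryGroup_iff']
    ext i j
    have := orthonormal_iff_ite.1 b.orthonormal i j
    rw [Matrix.mul_apply, Matrix.one_apply, ← this]
    simp [PiLp.inner_apply, mul_comm]
  · ext k i
    rw [Matrix.mul_diagonal]
    by_cases hi : s i = 0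
    · have h0 := hin i i
      simp only [hi, if_true] at h0
      have : ∑ k, ‖M k i‖ ^ 2 = 0 := by
        have h1 : ((∑ k, ‖M k i‖ ^ 2 : ℝ) : ℂ) = ∑ k, star (M k i) * M k i := by
          push_cast
          refine Finset.sum_congr rfl fun k _ => ?_
          rw [← Complex.conj_mul', starRingEnd_apply]
        rw [h0] at h1
        rw [show (0 : ℝ) ^ 2 = 0 by norm_num] at h1
        exact_mod_cast h1
      have := (Finset.sum_eq_zero_iff_of_nonneg (fun _ _ => by positivity)).1 this k (by simp)
      simp [hi]
      simpa using this
    · have hi' : (s i : ℂ) ≠ 0 := by exact_mod_cast hi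
      rw [Matrix.of_apply, hb i hi]
      simp only [v]
      field_simp

/-- Diagonalize `|A|` by `V`. The columns of `A V` are then orthogonal with norms the eigenvalues of
`|A|`, and normalizing them gives `W`. -/
theorem exists_svd (A : Matrix m m ℂ) :
    ∃ W ∈ Matrix.unitaryGroup m ℂ, ∃ V ∈ Matrix.unitaryGroup m ℂ, ∃ s : m → ℝ, (∀ i, 0 ≤ s i) ∧
      A = W * Matrix.diagonal (fun i => (s i : ℂ)) * star V ∧
      CFC.abs A = V * Matrix.diagonal (fun i => (s i : ℂ)) * star V ∧
      ∀ r : ℝ, CFC.abs A ^ r = V * Matrix.diagonal (fun i => ((s i ^ r : ℝ) : ℂ)) * star V := by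
  have hpos : (CFC.abs A).PosSemidef := Matrix.nonneg_iff_posSemidef.1 (CFC.abs_nonneg A)
  have hH := hpos.isHermitian
  let V : Matrix m m ℂ := (hH.eigenvectorUnitary : Matrix m m ℂ)
  have hVu : V ∈ Matrix.unitaryGroup m ℂ := hH.eigenvectorUnitary.2
  have hspec : CFC.abs A = V * Matrix.diagonal (fun i => (hH.eigenvalues i : ℂ)) * star V := by
    conv_lhs => rw [hH.spectral_theorem]
    rfl
  have hVV : star V * V = 1 := Matrix.mem_unitaryGroup_iff'.1 hVu
  have hVV' : V * star V = 1 := Matrix.mem_unitaryGroup_iff.1 hVu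
  have hsq : (A * V)ᴴ * (A * V) =
      Matrix.diagonal fun i => ((hH.eigenvalues i ^ 2 : ℝ) : ℂ) := by
    have h1 : (A * V)ᴴ * (A * V) = star V * (star A * A) * V := by
      simp [Matrix.conjTranspose_mul, Matrix.star_eq_conjTranspose, Matrix.mul_assoc]
    have h2 : star A * A = V * Matrix.diagonal (fun i => (hH.eigenvalues i : ℂ)) * star V *
        (V * Matrix.diagonal (fun i => (hH.eigenvalues i : ℂ)) * star V) := by
      rw [← hspec, CFC.abs_mul_abs]
    rw [h1, h2]
    calc _ = (star V * V) * Matrix.diagonal (fun i => (hH.eigenvalues i : ℂ)) * (star V * V) *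
          Matrix.diagonal (fun i => (hH.eigenvalues i : ℂ)) * (star V * V) := by
            simp only [Matrix.mul_assoc]
      _ = _ := by simp [hVV, Matrix.diagonal_mul_diagonal, sq]
  obtain ⟨W, hW, hWA⟩ := exists_unitary_mul_diagonal_of_conjTranspose_mul_self _ _ hsq
  refine ⟨W, hW, V, hVu, hH.eigenvalues, hpos.eigenvalues_nonneg, ?_, hspec, fun r => ?_⟩
  · rw [← hWA, Matrix.mul_assoc, hVV', Matrix.mul_one]
  · rw [CFC.rpow_def, cfc_nnreal_eq_real _ _ (CFC.abs_nonneg A), hH.cfc_eq]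
    have : ((RCLike.ofReal : ℝ → ℂ) ∘ (fun x : ℝ => (((x.toNNReal ^ r : ℝ≥0)) : ℝ)) ∘
        hH.eigenvalues) = fun i => ((hH.eigenvalues i ^ r : ℝ) : ℂ) := by
      ext i
      simp [max_eq_left (hpos.eigenvalues_nonneg i)]
    rw [Matrix.IsHermitian.cfc, this]
    rfl

theorem exists_polar (A : Matrix m m ℂ) : ∃ W ∈ Matrix.unitaryGroup m ℂ, A = W * CFC.abs A := by
  obtain ⟨W, hW, V, hV, s, -, hA, hA', -⟩ := exists_svd A
  refine ⟨W * star V, mul_mem hW (Unitary.star_mem hV), ?_⟩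
  rw [hA']
  calc A = W * 1 * Matrix.diagonal (fun i => (s i : ℂ)) * star V := by rw [Matrix.mul_one, ← hA]
    _ = _ := by
      rw [← Matrix.mem_unitaryGroup_iff'.1 hV]
      simp only [Matrix.mul_assoc]

theorem trace_unitary_conj {V : Matrix m m ℂ} (hV : V ∈ Matrix.unitaryGroup m ℂ)
    (A : Matrix m m ℂ) : (V * A * star V).trace = A.trace := by
  rw [Matrix.trace_mul_comm, ← Matrix.mul_assoc, Matrix.mem_unitaryGroup_iff'.1 hV, Matrix.one_mul]

theorem exists_svd_trace (A : Matrix m m ℂ) :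
    ∃ W ∈ Matrix.unitaryGroup m ℂ, ∃ V ∈ Matrix.unitaryGroup m ℂ, ∃ s : m → ℝ, (∀ i, 0 ≤ s i) ∧
      A = W * Matrix.diagonal (fun i => (s i : ℂ)) * star V ∧
      ∀ r : ℝ, (Matrix.trace (CFC.abs A ^ r)).re = ∑ i, s i ^ r := by
  obtain ⟨W, hW, V, hV, s, hs, hA, -, hr⟩ := exists_svd A
  refine ⟨W, hW, V, hV, s, hs, hA, fun r => ?_⟩
  rw [hr, trace_unitary_conj hV, Matrix.trace_diagonal, ← Complex.ofReal_sum, Complex.ofReal_re]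

theorem sum_row_sq_of_unitary {B : Matrix m m ℂ} (hB : B ∈ Matrix.unitaryGroup m ℂ) (i : m) :
    ∑ k, ‖B i k‖ ^ 2 = 1 := by
  have := congrFun (congrFun (Matrix.mem_unitaryGroup_iff.1 hB) i) i
  rw [Matrix.mul_apply, Matrix.one_apply_eq] at this
  have h : ((∑ k, ‖B i k‖ ^ 2 : ℝ) : ℂ) = 1 := by
    rw [← this]
    push_cast
    refine Finset.sum_congr rfl fun k _ => ?_
    rw [← Complex.mul_conj', Matrix.star_apply, starRingEnd_apply]
  exact_mod_cast h

theorem sum_col_sq_of_unitary {B : Matrix m m ℂ} (hB : B ∈ Matrix.unitaryGroup m ℂ) (i : m) :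
    ∑ k, ‖B k i‖ ^ 2 = 1 := by
  simpa using sum_row_sq_of_unitary (Unitary.star_mem hB) i

/-- Each diagonal entry is bounded by an average of the singular values. The weights `w i k = (|B i
k|² + |D k i|²) / 2`, from the arithmetic-geometric mean inequality, are doubly stochastic because
`B` and `D` are unitary, so convexity of `t ↦ t ^ r` finishes. With `exists_sum_diag_rpow_eq` this
makes the Schatten norm a maximum of `ℓ_q` norms of diagonals, hence a seminorm. -/
theorem sum_diag_rpow_le {r : ℝ} (hr : 1 ≤ r) (A : Matrix m m ℂ) {V W : Matrix m m ℂ}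
    (hV : V ∈ Matrix.unitaryGroup m ℂ) (hW : W ∈ Matrix.unitaryGroup m ℂ) :
    ∑ i, ‖(V * A * W) i i‖ ^ r ≤ (Matrix.trace (CFC.abs A ^ r)).re := by
  obtain ⟨X, hX, Z, hZ, s, hs, hA, htr⟩ := exists_svd_trace A
  rw [htr]
  set B := V * X
  set D := star Z * W
  have hB : B ∈ Matrix.unitaryGroup m ℂ := mul_mem hV hX
  have hD : D ∈ Matrix.unitaryGroup m ℂ := mul_mem (Unitary.star_mem hZ) hW
  have hmul : V * A * W = B * Matrix.diagonal (fun i => (s i : ℂ)) * D := by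
    rw [hA]; simp only [B, D, Matrix.mul_assoc]
  let w : m → m → ℝ := fun i k => (‖B i k‖ ^ 2 + ‖D k i‖ ^ 2) / 2
  have hw0 : ∀ i k, 0 ≤ w i k := fun i k => by positivity
  have hw1 : ∀ i, ∑ k, w i k = 1 := fun i => by
    simp only [w, ← Finset.sum_div, Finset.sum_add_distrib, sum_row_sq_of_unitary hB,
      sum_col_sq_of_unitary hD]
    norm_num
  have hw2 : ∀ k, ∑ i, w i k = 1 := fun k => by
    simp only [w, ← Finset.sum_div, Finset.sum_add_distrib, sum_row_sq_of_unitary hD,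
      sum_col_sq_of_unitary hB]
    norm_num
  have hle : ∀ i, ‖(V * A * W) i i‖ ≤ ∑ k, w i k * s k := fun i => by
    rw [hmul, Matrix.mul_apply]
    refine (norm_sum_le _ _).trans (Finset.sum_le_sum fun k _ => ?_)
    rw [Matrix.mul_diagonal, norm_mul, norm_mul, Complex.norm_of_nonneg (hs k)]
    have := two_mul_le_add_sq ‖B i k‖ ‖D k i‖
    simp only [w]
    nlinarith [hs k]
  calc ∑ i, ‖(V * A * W) i i‖ ^ r ≤ ∑ i, ∑ k, w i k * s k ^ r := by
        refine Finset.sum_le_sum fun i _ => ?_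
        refine (Real.rpow_le_rpow (norm_nonneg _) (hle i) (by linarith)).trans ?_
        exact Real.rpow_arith_mean_le_arith_mean_rpow _ _ _ (fun k _ => hw0 i k) (hw1 i)
          (fun k _ => hs k) hr
    _ = ∑ k, s k ^ r := by
        rw [Finset.sum_comm]
        simp only [← Finset.sum_mul, hw2, one_mul]

theorem exists_sum_diag_rpow_eq (r : ℝ) (A : Matrix m m ℂ) :
    ∃ V ∈ Matrix.unitaryGroup m ℂ, ∃ W ∈ Matrix.unitaryGroup m ℂ,
      (Matrix.trace (CFC.abs A ^ r)).re = ∑ i, ‖(V * A * W) i i‖ ^ r := by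
  obtain ⟨X, hX, Z, hZ, s, hs, hA, htr⟩ := exists_svd_trace A
  refine ⟨star X, Unitary.star_mem hX, Z, hZ, ?_⟩
  have : star X * A * Z = Matrix.diagonal (fun i => (s i : ℂ)) := by
    rw [hA]
    calc _ = (star X * X) * Matrix.diagonal (fun i => (s i : ℂ)) * (star Z * Z) := by
          simp only [Matrix.mul_assoc]
      _ = _ := by
          rw [Matrix.mem_unitaryGroup_iff'.1 hX, Matrix.mem_unitaryGroup_iff'.1 hZ]; simp
  rw [htr, this]
  simp [abs_of_nonneg, hs]

theorem schattenNorm_of_ne_top {q : ℝ≥0∞} (hq : q ≠ ∞) (A : Matrix m m ℂ) :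
    schattenNorm q A = (Matrix.trace (CFC.abs A ^ q.toReal)).re ^ (1 / q.toReal) := by
  simp [schattenNorm, hq]

theorem schattenNorm_top (A : Matrix m m ℂ) :
    schattenNorm ∞ A = ‖Matrix.toEuclideanCLM (n := m) (𝕜 := ℂ) A‖ := by
  simp [schattenNorm]

theorem one_le_toReal {q : ℝ≥0∞} (hq : 1 ≤ q) (hq' : q ≠ ∞) : 1 ≤ q.toReal := by
  simpa using ENNReal.toReal_mono hq' hq

theorem le_schattenNorm {q : ℝ≥0∞} (hq : 1 ≤ q) (hq' : q ≠ ∞) (A : Matrix m m ℂ)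
    {V W : Matrix m m ℂ} (hV : V ∈ Matrix.unitaryGroup m ℂ) (hW : W ∈ Matrix.unitaryGroup m ℂ) :
    (∑ i, ‖(V * A * W) i i‖ ^ q.toReal) ^ (1 / q.toReal) ≤ schattenNorm q A := by
  rw [schattenNorm_of_ne_top hq']
  have := one_le_toReal hq hq'
  refine Real.rpow_le_rpow ?_ (sum_diag_rpow_le this A hV hW) (by positivity)
  exact Finset.sum_nonneg fun _ _ => by positivity

theorem exists_schattenNorm_eq {q : ℝ≥0∞} (hq' : q ≠ ∞) (A : Matrix m m ℂ) :
    ∃ V ∈ Matrix.unitaryGroup m ℂ, ∃ W ∈ Matrix.unitaryGroup m ℂ,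
      schattenNorm q A = (∑ i, ‖(V * A * W) i i‖ ^ q.toReal) ^ (1 / q.toReal) := by
  rw [schattenNorm_of_ne_top hq']
  obtain ⟨V, hV, W, hW, h⟩ := exists_sum_diag_rpow_eq q.toReal A
  exact ⟨V, hV, W, hW, by rw [h]⟩

/-- The Schatten norm as a seminorm. -/
noncomputable def schattenSeminorm (m : Type*) [Fintype m] [DecidableEq m] (q : ℝ≥0∞)
    (hq : 1 ≤ q) : Seminorm ℂ (Matrix m m ℂ) :=
  Seminorm.ofSMulLE (schattenNorm q)
    (by
      by_cases hq' : q = ∞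
      · subst hq'
        simp [schattenNorm_top]
      · obtain ⟨V, -, W, -, h⟩ := exists_schattenNorm_eq hq' (0 : Matrix m m ℂ)
        have := one_le_toReal hq hq'
        rw [h]
        simp [Real.zero_rpow (by positivity : q.toReal ≠ 0),
          Real.zero_rpow (by positivity : (q.toReal)⁻¹ ≠ 0)])
    (fun A B => by
      by_cases hq' : q = ∞
      · subst hq'
        simp only [schattenNorm_top, map_add]
        exact norm_add_le _ _
      -- With `V`, `W` attaining the norm of `A + B`, the triangle inequality is Minkowski's
      -- inequality for the diagonals of `V A W` and `V B W`.
      · obtain ⟨V, hV, W, hW, h⟩ := exists_schattenNorm_eq hq' (A + B)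
        have h1 := one_le_toReal hq hq'
        rw [h]
        refine le_trans ?_ (add_le_add (le_schattenNorm hq hq' A hV hW)
          (le_schattenNorm hq hq' B hV hW))
        refine le_trans ?_ (Real.Lp_add_le_of_nonneg Finset.univ h1
          (fun i _ => norm_nonneg _) (fun i _ => norm_nonneg _))
        refine Real.rpow_le_rpow (Finset.sum_nonneg fun _ _ => by positivity)
          (Finset.sum_le_sum fun i _ => Real.rpow_le_rpow (norm_nonneg _) ?_ (by positivity))
          (by positivity)
        rw [Matrix.mul_add, Matrix.add_mul]
        exact norm_add_le _ _)
    (fun c A => by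
      by_cases hq' : q = ∞
      · subst hq'
        simp only [schattenNorm_top, map_smul, norm_smul, le_refl]
      · obtain ⟨V, hV, W, hW, h⟩ := exists_schattenNorm_eq hq' (c • A)
        have h1 := one_le_toReal hq hq'
        rw [h]
        refine le_trans (le_of_eq ?_)
          (mul_le_mul_of_nonneg_left (le_schattenNorm hq hq' A hV hW) (norm_nonneg c))
        simp only [Matrix.mul_smul, Matrix.smul_mul, Matrix.smul_apply, norm_smul]
        simp only [Real.mul_rpow (norm_nonneg _) (norm_nonneg _), ← Finset.mul_sum]
        rw [Real.mul_rpow (by positivity) (Finset.sum_nonneg fun _ _ => by positivity),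
          ← Real.rpow_mul (norm_nonneg _), mul_one_div_cancel (by positivity), Real.rpow_one])

theorem schattenSeminorm_apply {q : ℝ≥0∞} (hq : 1 ≤ q) (A : Matrix m m ℂ) :
    schattenSeminorm m q hq A = schattenNorm q A := rfl

theorem schattenNorm_mul_unitary_le {q : ℝ≥0∞} (hq : 1 ≤ q) (A : Matrix m m ℂ) {Q : Matrix m m ℂ}
    (hQ : Q ∈ Matrix.unitaryGroup m ℂ) : schattenNorm q (A * Q) ≤ schattenNorm q A := by
  by_cases hq' : q = ∞
  · subst hq'
    simp only [schattenNorm_top, map_mul]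
    refine (norm_mul_le _ _).trans (mul_le_of_le_one_right (norm_nonneg _) ?_)
    have hu : Matrix.toEuclideanCLM (n := m) (𝕜 := ℂ) Q ∈
        unitary (EuclideanSpace ℂ m →L[ℂ] EuclideanSpace ℂ m) :=
      Unitary.map_mem (Matrix.toEuclideanCLM (n := m) (𝕜 := ℂ)) hQ
    refine ContinuousLinearMap.opNorm_le_bound _ zero_le_one fun x => ?_
    have := ContinuousLinearMap.norm_map_of_mem_unitary hu x
    rw [this, one_mul]
  · obtain ⟨V, hV, W, hW, h⟩ := exists_schattenNorm_eq hq' (A * Q)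
    rw [h]
    have := le_schattenNorm hq hq' A hV (mul_mem hQ hW)
    simpa only [Matrix.mul_assoc] using this

/-- Right multiplication by an orthogonal projection is a contraction for the Schatten norms. -/
theorem schattenNorm_mul_projection_le {q : ℝ≥0∞} (hq : 1 ≤ q) (A : Matrix m m ℂ)
    {Q : Matrix m m ℂ} (hQ : IsStarProjection Q) :
    schattenNorm q (A * Q) ≤ schattenNorm q A := by
  -- The reflection `2Q - 1` is unitary, and `A Q` is the mean of `A` and `A (2Q - 1)`.
  have hu : (2 : ℂ) • Q - 1 ∈ Matrix.unitaryGroup m ℂ := by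
    rw [Matrix.mem_unitaryGroup_iff]
    have h1 : star Q = Q := hQ.isSelfAdjoint
    have h2 : Q * Q = Q := hQ.isIdempotentElem
    simp only [star_sub, star_smul, h1, star_one, mul_sub, sub_mul, mul_one, one_mul,
      Matrix.smul_mul, Matrix.mul_smul, h2]
    ext i j
    simp
    ring
  have heq : A * Q = (1 / 2 : ℂ) • A + (1 / 2 : ℂ) • (A * ((2 : ℂ) • Q - 1)) := by
    rw [mul_sub, Matrix.mul_smul, smul_sub, smul_smul]
    simp
  have h := map_add_le_add (schattenSeminorm m q hq) ((1 / 2 : ℂ) • A)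
    ((1 / 2 : ℂ) • (A * ((2 : ℂ) • Q - 1)))
  rw [← heq, map_smul_eq_mul, map_smul_eq_mul] at h
  have h3 := schattenNorm_mul_unitary_le hq A hu
  simp only [schattenSeminorm_apply] at h
  norm_num at h
  linarith

end Schatten

/-! ### Invariance of the Gaussian matrix law -/

section Gaussian

theorem charFun_complexGaussian (z : ℂ) :
    charFun (((gaussianReal 0 1).prod (gaussianReal 0 1)).map
      fun g : ℝ × ℝ => (g.1 + g.2 * Complex.I : ℂ)) z = Complex.exp (-‖z‖ ^ 2 / 2) := by
  rw [charFun_apply, integral_map (Measurable.aemeasurable (by fun_prop))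
    (Measurable.aestronglyMeasurable (by fun_prop))]
  have h : ∀ g : ℝ × ℝ, Complex.exp (inner ℝ (g.1 + g.2 * Complex.I : ℂ) z * Complex.I) =
      Complex.exp (z.re * g.1 * Complex.I) * Complex.exp (z.im * g.2 * Complex.I) := by
    intro g
    rw [← Complex.exp_add, Complex.inner]
    congr 1
    simp
    ring
  simp_rw [h]
  rw [integral_prod_mul (fun x : ℝ => Complex.exp (z.re * x * Complex.I))
    (fun x : ℝ => Complex.exp (z.im * x * Complex.I)), ← charFun_apply_real, ← charFun_apply_real,
    charFun_gaussianReal, charFun_gaussianReal, ← Complex.exp_add]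
  congr 1
  have : (‖z‖ : ℂ) ^ 2 = z.re ^ 2 + z.im ^ 2 := by
    rw [← Complex.ofReal_pow, ← Complex.normSq_eq_norm_sq, Complex.normSq_apply]
    push_cast
    ring
  rw [this]
  simp
  ring

/-- Characteristic functions agree: real and imaginary parts of unit variance give `exp (-‖z‖²/2)`
in each coordinate. The matrix law thereby inherits the isometry and rotation invariance of
`stdGaussian`. -/
theorem map_pi_complexGaussian (ι : Type*) [Fintype ι] :
    (Measure.pi fun _ : ι => (gaussianReal 0 1).prod (gaussianReal 0 1)).map
      (fun g => WithLp.toLp 2 fun i => ((g i).1 + (g i).2 * Complex.I : ℂ)) =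
    stdGaussian (EuclideanSpace ℂ ι) := by
  have h1 : (Measure.pi fun _ : ι => (gaussianReal 0 1).prod (gaussianReal 0 1)).map
      (fun g i => ((g i).1 + (g i).2 * Complex.I : ℂ)) = Measure.pi fun _ : ι =>
        (((gaussianReal 0 1).prod (gaussianReal 0 1)).map
          fun g : ℝ × ℝ => (g.1 + g.2 * Complex.I : ℂ)) := by
    have : ∀ _ : ι, IsProbabilityMeasure (((gaussianReal 0 1).prod (gaussianReal 0 1)).map
          fun g : ℝ × ℝ => (g.1 + g.2 * Complex.I : ℂ)) := fun _ =>
      Measure.isProbabilityMeasure_map (Measurable.aemeasurable (by fun_prop))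
    exact Measure.pi_map_pi (f := fun (_ : ι) (g : ℝ × ℝ) => (g.1 + g.2 * Complex.I : ℂ))
      (fun _ => Measurable.aemeasurable (by fun_prop))
  have h2 : (Measure.pi fun _ : ι => (gaussianReal 0 1).prod (gaussianReal 0 1)).map
      (fun g => WithLp.toLp 2 fun i => ((g i).1 + (g i).2 * Complex.I : ℂ)) =
      (Measure.pi fun _ : ι => (((gaussianReal 0 1).prod (gaussianReal 0 1)).map
          fun g : ℝ × ℝ => (g.1 + g.2 * Complex.I : ℂ))).map (WithLp.toLp 2) := by
    rw [← h1, Measure.map_map (by fun_prop) (by fun_prop)]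
    rfl
  have : IsProbabilityMeasure (((gaussianReal 0 1).prod (gaussianReal 0 1)).map
          fun g : ℝ × ℝ => (g.1 + g.2 * Complex.I : ℂ)) :=
      Measure.isProbabilityMeasure_map (Measurable.aemeasurable (by fun_prop))
  have : IsProbabilityMeasure ((Measure.pi fun _ : ι => (((gaussianReal 0 1).prod
      (gaussianReal 0 1)).map fun g : ℝ × ℝ => (g.1 + g.2 * Complex.I : ℂ))).map
        (WithLp.toLp 2)) :=
      Measure.isProbabilityMeasure_map (Measurable.aemeasurable (by fun_prop))
  rw [h2]
  apply Measure.ext_of_charFun (E := EuclideanSpace ℂ ι)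
  ext t
  rw [charFun_stdGaussian, charFun_pi]
  simp_rw [charFun_complexGaussian]
  rw [← Complex.exp_sum]
  congr 1
  rw [← Complex.ofReal_pow, EuclideanSpace.norm_sq_eq]
  push_cast
  simp [Finset.sum_div, neg_div]

/-- The linear map that carries the standard Gaussian measure to `gaussianMatrix N`. -/
noncomputable def scaledMatrix (N : ℕ) :
    EuclideanSpace ℂ (Fin N × Fin N) →ₗ[ℂ] Matrix (Fin N) (Fin N) ℂ where
  toFun v := Matrix.of fun i j => (((Real.sqrt (2 * N))⁻¹ : ℝ) : ℂ) * v (i, j)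
  map_add' v w := by ext i j; simp [mul_add]
  map_smul' c v := by ext i j; simp; ring

theorem scaledMatrix_apply (N : ℕ) (v : EuclideanSpace ℂ (Fin N × Fin N)) (i j : Fin N) :
    scaledMatrix N v i j = (((Real.sqrt (2 * N))⁻¹ : ℝ) : ℂ) * v (i, j) := rfl

theorem measurable_matrix_iff {α : Type*} [MeasurableSpace α] {m n : Type*}
    {f : α → Matrix m n ℂ} :
    Measurable f ↔ ∀ i j, Measurable fun a => f a i j := by
  refine ⟨fun h i j => ?_, fun h => ?_⟩
  · exact (measurable_pi_apply j).comp ((measurable_pi_apply i).comp h)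
  · exact measurable_pi_lambda _ fun i => measurable_pi_lambda _ fun j => h i j

theorem measurable_entry {m n : Type*} (i : m) (j : n) :
    Measurable fun A : Matrix m n ℂ => A i j :=
  measurable_matrix_iff.1 measurable_id i j

theorem measurable_scaledMatrix (N : ℕ) : Measurable (scaledMatrix N) := by
  rw [measurable_matrix_iff]
  intro i j
  simp only [scaledMatrix_apply]
  fun_prop

theorem gaussianMatrix_eq_map_stdGaussian (N : ℕ) :
    gaussianMatrix N = (stdGaussian (EuclideanSpace ℂ (Fin N × Fin N))).map (scaledMatrix N) := by
  rw [← map_pi_complexGaussian, Measure.map_map (measurable_scaledMatrix N) (by fun_prop)]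
  rfl

instance (N : ℕ) : IsProbabilityMeasure (gaussianMatrix N) := by
  rw [gaussianMatrix_eq_map_stdGaussian]
  exact Measure.isProbabilityMeasure_map (measurable_scaledMatrix N).aemeasurable

theorem sum_norm_sq_eq_trace {m n : Type*} [Fintype m] [Fintype n] (A : Matrix m n ℂ) :
    ((∑ i, ∑ j, ‖A i j‖ ^ 2 : ℝ) : ℂ) = (Aᴴ * A).trace := by
  rw [Finset.sum_comm]
  simp only [Matrix.trace, Matrix.diag, Matrix.mul_apply, Matrix.conjTranspose_apply]
  push_cast
  refine Finset.sum_congr rfl fun i _ => Finset.sum_congr rfl fun j _ => ?_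
  rw [← Complex.conj_mul', starRingEnd_apply]

/-- The law `gaussianMatrix N` is invariant under linear maps preserving the Hilbert-Schmidt
norm. -/
theorem gaussianMatrix_map_eq_self {N : ℕ}
    (φ : Matrix (Fin N) (Fin N) ℂ →ₗ[ℂ] Matrix (Fin N) (Fin N) ℂ)
    (hφ : ∀ A, ∑ i, ∑ j, ‖φ A i j‖ ^ 2 = ∑ i, ∑ j, ‖A i j‖ ^ 2) :
    (gaussianMatrix N).map φ = gaussianMatrix N := by
  let e : EuclideanSpace ℂ (Fin N × Fin N) ≃ₗ[ℂ] Matrix (Fin N) (Fin N) ℂ :=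
    { toFun := fun v => Matrix.of fun i j => v (i, j)
      invFun := fun A => WithLp.toLp 2 fun i => A i.1 i.2
      map_add' := fun _ _ => rfl
      map_smul' := fun _ _ => rfl
      left_inv := fun _ => rfl
      right_inv := fun _ => rfl }
  let ψ : EuclideanSpace ℂ (Fin N × Fin N) →ₗ[ℂ] EuclideanSpace ℂ (Fin N × Fin N) :=
    e.symm.toLinearMap ∘ₗ φ ∘ₗ e.toLinearMap
  have hnorm : ∀ v : EuclideanSpace ℂ (Fin N × Fin N), ‖v‖ ^ 2 = ∑ i, ∑ j, ‖e v i j‖ ^ 2 := by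
    intro v
    rw [EuclideanSpace.norm_sq_eq, Fintype.sum_prod_type]
    rfl
  have hψ : ∀ v, ‖ψ v‖ = ‖v‖ := by
    intro v
    refine (sq_eq_sq₀ (norm_nonneg _) (norm_nonneg _)).1 ?_
    rw [hnorm, hnorm, ← hφ (e v)]
    simp [ψ]
  -- The invariance of `stdGaussian` is under real linear isometric equivalences. An isometry of a
  -- finite-dimensional space into itself is one.
  let ψ' : EuclideanSpace ℂ (Fin N × Fin N) →ₗᵢ[ℝ] EuclideanSpace ℂ (Fin N × Fin N) :=
    ⟨⟨⟨ψ, ψ.map_add⟩, fun r v => by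
      have := ψ.map_smul (r : ℂ) v
      exact this⟩, hψ⟩
  let Ψ := ψ'.toLinearIsometryEquiv rfl
  have hcomm : φ ∘ scaledMatrix N = scaledMatrix N ∘ Ψ := by
    ext1 v
    have h1 : ∀ v, scaledMatrix N v = (((Real.sqrt (2 * N))⁻¹ : ℝ) : ℂ) • e v := fun v => rfl
    change φ (scaledMatrix N v) = scaledMatrix N (ψ v)
    rw [h1, h1, map_smul]
    simp [ψ]
  have hφm : Measurable φ := by
    rw [measurable_matrix_iff]
    intro i j
    have : (fun A => φ A i j) = fun A : Matrix (Fin N) (Fin N) ℂ =>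
        ∑ k, ∑ l, A k l * φ (Matrix.single k l 1) i j := by
      ext A
      conv_lhs => rw [Matrix.matrix_eq_sum_single A]
      simp only [map_sum, Matrix.sum_apply]
      refine Finset.sum_congr rfl fun k _ => Finset.sum_congr rfl fun l _ => ?_
      have : Matrix.single k l (A k l) = A k l • Matrix.single k l (1 : ℂ) := by
        simp [Matrix.smul_single]
      rw [this, map_smul]
      rfl
    rw [this]
    exact Finset.measurable_sum _ fun k _ => Finset.measurable_sum _ fun l _ =>
      (measurable_entry k l).mul_const _
  rw [gaussianMatrix_eq_map_stdGaussian, Measure.map_map hφm (measurable_scaledMatrix N), hcomm,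
    ← Measure.map_map (measurable_scaledMatrix N) Ψ.continuous.measurable, stdGaussian_map Ψ]

theorem gaussianMatrix_map_mul_left {N : ℕ} {u : Matrix (Fin N) (Fin N) ℂ}
    (hu : u ∈ Matrix.unitaryGroup (Fin N) ℂ) :
    (gaussianMatrix N).map (fun A => u * A) = gaussianMatrix N := by
  refine gaussianMatrix_map_eq_self (LinearMap.mulLeft ℂ u) fun A => ?_
  have h := sum_norm_sq_eq_trace (u * A)
  have : (u * A)ᴴ * (u * A) = Aᴴ * (star u * u) * A := by
    simp [Matrix.conjTranspose_mul, Matrix.star_eq_conjTranspose, Matrix.mul_assoc]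
  rw [this, Matrix.mem_unitaryGroup_iff'.1 hu, Matrix.mul_one, ← sum_norm_sq_eq_trace] at h
  exact_mod_cast h

theorem gaussianMatrix_map_mul_right {N : ℕ} {u : Matrix (Fin N) (Fin N) ℂ}
    (hu : u ∈ Matrix.unitaryGroup (Fin N) ℂ) :
    (gaussianMatrix N).map (fun A => A * u) = gaussianMatrix N := by
  refine gaussianMatrix_map_eq_self (LinearMap.mulRight ℂ u) fun A => ?_
  have h := sum_norm_sq_eq_trace (A * u)
  have : (A * u)ᴴ * (A * u) = star u * (Aᴴ * A) * star (star u) := by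
    simp [Matrix.conjTranspose_mul, Matrix.star_eq_conjTranspose, Matrix.mul_assoc]
  rw [this, trace_unitary_conj (Unitary.star_mem hu), ← sum_norm_sq_eq_trace] at h
  exact_mod_cast h

theorem gaussianMatrix_map_phase {N : ℕ} (d : Fin N → Fin N → ℂ) (hd : ∀ i j, ‖d i j‖ = 1) :
    (gaussianMatrix N).map (fun A => Matrix.of fun i j => d i j * A i j) = gaussianMatrix N := by
  refine gaussianMatrix_map_eq_self
    { toFun := fun A : Matrix (Fin N) (Fin N) ℂ => Matrix.of fun i j => d i j * A i j
      map_add' := fun A B => by ext i j; simp [mul_add]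
      map_smul' := fun c A => by ext i j; simp; ring } fun A => ?_
  simp [hd]

/-- Rotation by `π/4` gives `(y - x)/√2` in the second coordinate. The symmetry of the law under `x
↦ -x` corrects the sign. -/
theorem map_rotation_stdGaussian (E : Type*) [NormedAddCommGroup E] [InnerProductSpace ℝ E]
    [FiniteDimensional ℝ E] [MeasurableSpace E] [BorelSpace E] :
    ((stdGaussian E).prod (stdGaussian E)).map
      (fun x => ((Real.sqrt 2)⁻¹ • (x.1 + x.2), (Real.sqrt 2)⁻¹ • (x.1 - x.2))) =
      (stdGaussian E).prod (stdGaussian E) := by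
  have h := IsGaussian.map_rotation_eq_self (μ := stdGaussian E) (by simp) (Real.pi / 4)
  have hneg : (stdGaussian E).map (fun x => -x) = stdGaussian E :=
    stdGaussian_map (LinearIsometryEquiv.neg ℝ)
  have h2 : ((stdGaussian E).prod (stdGaussian E)).map (Prod.map id fun x => -x) =
      (stdGaussian E).prod (stdGaussian E) := by
    rw [← Measure.map_prod_map _ _ measurable_id measurable_neg, hneg, Measure.map_id]
  conv_rhs => rw [← h2, ← h, Measure.map_map (by fun_prop) (by fun_prop)]
  congr 1
  ext x
  · simp [ContinuousLinearMap.rotation_apply, Real.sqrt_div_self']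
  · simp [ContinuousLinearMap.rotation_apply, Real.sqrt_div_self']
    rw [smul_sub]
    abel

end Gaussian

/-! ### The rotated pair, and second and fourth moments of the entries -/

section Moments

/-- The scalar `1 / √2`. -/
noncomputable def invSqrtTwo : ℂ := ((Real.sqrt 2)⁻¹ : ℝ)

theorem conj_invSqrtTwo : starRingEnd ℂ invSqrtTwo = invSqrtTwo := Complex.conj_ofReal _

theorem invSqrtTwo_mul_self : invSqrtTwo * invSqrtTwo = 1 / 2 := by
  rw [invSqrtTwo, ← Complex.ofReal_mul, ← mul_inv, Real.mul_self_sqrt zero_le_two]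
  norm_num

theorem measurable_matrix_smul {m n : Type*} (c : ℂ) :
    Measurable fun A : Matrix m n ℂ => c • A :=
  measurable_matrix_iff.2 fun i j => (measurable_entry i j).const_mul c

theorem measurable_matrix_add {m n : Type*} :
    Measurable fun x : Matrix m n ℂ × Matrix m n ℂ => x.1 + x.2 :=
  measurable_matrix_iff.2 fun i j =>
    ((measurable_entry i j).comp measurable_fst).add ((measurable_entry i j).comp measurable_snd)

theorem measurable_matrix_sub {m n : Type*} :
    Measurable fun x : Matrix m n ℂ × Matrix m n ℂ => x.1 - x.2 :=
  measurable_matrix_iff.2 fun i j =>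
    ((measurable_entry i j).comp measurable_fst).sub ((measurable_entry i j).comp measurable_snd)

/-- The rotation by `π / 4`, followed by a reflection, of a pair of matrices. -/
noncomputable def rotatePair {N : ℕ} (x : Matrix (Fin N) (Fin N) ℂ × Matrix (Fin N) (Fin N) ℂ) :
    Matrix (Fin N) (Fin N) ℂ × Matrix (Fin N) (Fin N) ℂ :=
  (invSqrtTwo • (x.1 + x.2), invSqrtTwo • (x.1 - x.2))

theorem measurable_rotatePair {N : ℕ} : Measurable (rotatePair (N := N)) :=
  ((measurable_matrix_smul _).comp measurable_matrix_add).prodMk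
    ((measurable_matrix_smul _).comp measurable_matrix_sub)

theorem map_rotatePair (N : ℕ) :
    ((gaussianMatrix N).prod (gaussianMatrix N)).map rotatePair =
      (gaussianMatrix N).prod (gaussianMatrix N) := by
  have h := map_rotation_stdGaussian (EuclideanSpace ℂ (Fin N × Fin N))
  rw [gaussianMatrix_eq_map_stdGaussian, Measure.map_prod_map _ _ (measurable_scaledMatrix N)
    (measurable_scaledMatrix N)]
  conv_rhs => rw [← h]
  rw [Measure.map_map measurable_rotatePair
      ((measurable_scaledMatrix N).prodMap (measurable_scaledMatrix N)),
    Measure.map_map ((measurable_scaledMatrix N).prodMap (measurable_scaledMatrix N))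
      (by fun_prop)]
  congr 1
  have hs : ∀ v, scaledMatrix N ((Real.sqrt 2)⁻¹ • v) = invSqrtTwo • scaledMatrix N v := fun v =>
    (scaledMatrix N).map_smul invSqrtTwo v
  ext1 x
  simp [rotatePair, hs]

theorem map_rotatePair_pi (N n : ℕ) :
    ((Measure.pi fun _ : Fin n => gaussianMatrix N).prod
      (Measure.pi fun _ : Fin n => gaussianMatrix N)).map
        (fun x => ((fun j => (rotatePair (x.1 j, x.2 j)).1),
          (fun j => (rotatePair (x.1 j, x.2 j)).2))) =
    (Measure.pi fun _ : Fin n => gaussianMatrix N).prod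
      (Measure.pi fun _ : Fin n => gaussianMatrix N) := by
  have h1 := measurePreserving_arrowProdEquivProdArrow (Matrix (Fin N) (Fin N) ℂ)
    (Matrix (Fin N) (Fin N) ℂ) (Fin n) (fun _ => gaussianMatrix N) (fun _ => gaussianMatrix N)
  have h2 : MeasurePreserving (rotatePair (N := N)) ((gaussianMatrix N).prod (gaussianMatrix N))
      ((gaussianMatrix N).prod (gaussianMatrix N)) := ⟨measurable_rotatePair, map_rotatePair N⟩
  have h3 := measurePreserving_pi (fun _ : Fin n => (gaussianMatrix N).prod (gaussianMatrix N))
    (fun _ : Fin n => (gaussianMatrix N).prod (gaussianMatrix N)) (fun _ => h2)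
  exact ((h1.comp h3).comp (h1.symm _)).map_eq

theorem integrable_pow_gaussianReal (k : ℕ) :
    Integrable (fun x : ℝ => x ^ k) (gaussianReal 0 1) := by
  have h := (memLp_id_gaussianReal' (μ := 0) (v := 1) k (by simp)).integrable_norm_pow'
  refine h.mono' (by fun_prop) (Filter.Eventually.of_forall fun x => ?_)
  simp

theorem integral_sq_gaussianReal : ∫ x, x ^ 2 ∂gaussianReal 0 1 = 1 := by
  have h := variance_fun_id_gaussianReal (μ := 0) (v := 1)
  rw [variance_eq_integral measurable_id'.aemeasurable] at h
  simpa using h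

/-- Since `(x + y)/√2` has the law of `x`, expanding its fourth power gives `m₄ = m₄/2 + 3/2`. The
odd terms vanish because the mean is zero. -/
theorem integral_pow_four_gaussianReal : ∫ x, x ^ 4 ∂gaussianReal 0 1 = 3 := by
  set μ := gaussianReal 0 1 with hμ
  have hrot := IsGaussian.map_rotation_eq_self (μ := μ) (by simp [hμ]) (Real.pi / 4)
  have h1 : ∫ x, x.1 ^ 4 ∂(μ.prod μ) = ∫ x, x ^ 4 ∂μ := by
    simpa using integral_prod_mul (μ := μ) (ν := μ) (fun x : ℝ => x ^ 4) (fun _ => 1)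
  have h2 : ∫ x, x.1 ^ 4 ∂(μ.prod μ) = ∫ x, ((x.1 + x.2) / Real.sqrt 2) ^ 4 ∂(μ.prod μ) := by
    conv_lhs => rw [← hrot]
    rw [integral_map (by fun_prop) (by fun_prop)]
    refine integral_congr_ae (Filter.Eventually.of_forall fun x => ?_)
    simp only [ContinuousLinearMap.rotation_apply, Real.cos_pi_div_four, Real.sin_pi_div_four,
      smul_eq_mul]
    rw [← mul_add, Real.sqrt_div_self']
    congr 1
    ring
  have hI : ∀ k l : ℕ, Integrable (fun x : ℝ × ℝ => x.1 ^ k * x.2 ^ l) (μ.prod μ) := fun k l =>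
    (integrable_pow_gaussianReal k).mul_prod (integrable_pow_gaussianReal l)
  have hP : ∀ k l : ℕ, ∫ x, x.1 ^ k * x.2 ^ l ∂(μ.prod μ) = (∫ x, x ^ k ∂μ) * ∫ x, x ^ l ∂μ :=
    fun k l => integral_prod_mul (fun x : ℝ => x ^ k) (fun x => x ^ l)
  have h3 : ∀ x : ℝ × ℝ, ((x.1 + x.2) / Real.sqrt 2) ^ 4 =
      (1 / 4) * (x.1 ^ 4 * x.2 ^ 0) + x.1 ^ 3 * x.2 ^ 1 + (3 / 2) * (x.1 ^ 2 * x.2 ^ 2) +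
        x.1 ^ 1 * x.2 ^ 3 + (1 / 4) * (x.1 ^ 0 * x.2 ^ 4) := by
    intro x
    have : Real.sqrt 2 ^ 4 = 4 := by
      rw [show 4 = 2 * 2 by norm_num, pow_mul, Real.sq_sqrt zero_le_two]; norm_num
    rw [div_pow, this]
    ring
  have hm : ∫ x, x ^ 1 ∂μ = 0 := by simp [hμ]
  simp_rw [h3] at h2
  rw [integral_add, integral_add, integral_add, integral_add, integral_const_mul,
    integral_const_mul, integral_const_mul, hP, hP, hP, hP, hP, h1, integral_sq_gaussianReal,
    hm] at h2
  · simp at h2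
    linarith
  · exact (hI 4 0).const_mul _
  · exact hI 3 1
  · exact ((hI 4 0).const_mul _).add (hI 3 1)
  · exact (hI 2 2).const_mul _
  · exact (((hI 4 0).const_mul _).add (hI 3 1)).add ((hI 2 2).const_mul _)
  · exact hI 1 3
  · exact ((((hI 4 0).const_mul _).add (hI 3 1)).add ((hI 2 2).const_mul _)).add (hI 1 3)
  · exact (hI 0 4).const_mul _

theorem integral_entry_gaussianMatrix {N : ℕ} (f : ℂ → ℝ) (hf : Measurable f) (i j : Fin N) :
    ∫ A, f (A i j) ∂gaussianMatrix N = ∫ x : ℝ × ℝ,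
      f ((((Real.sqrt (2 * N))⁻¹ : ℝ) : ℂ) * (x.1 + x.2 * Complex.I))
        ∂((gaussianReal 0 1).prod (gaussianReal 0 1)) := by
  rw [gaussianMatrix, integral_map]
  · have h := measurePreserving_eval (fun _ : Fin N × Fin N => (gaussianReal 0 1).prod
      (gaussianReal 0 1)) (i, j)
    conv_rhs => rw [← h.map_eq]
    rw [integral_map h.measurable.aemeasurable]
    · rfl
    · exact (hf.comp (by fun_prop)).aestronglyMeasurable
  · refine (measurable_matrix_iff.2 fun i j => ?_).aemeasurable
    simp only [Matrix.of_apply]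
    fun_prop
  · exact (hf.comp (measurable_entry i j)).aestronglyMeasurable

theorem integral_norm_sq_entry {N : ℕ} (i j : Fin N) :
    ∫ A, ‖A i j‖ ^ 2 ∂gaussianMatrix N = 1 / N := by
  have hN : (0 : ℝ) < N := by exact_mod_cast i.pos
  rw [integral_entry_gaussianMatrix (fun z => ‖z‖ ^ 2) (by fun_prop)]
  have h : ∀ x : ℝ × ℝ, ‖(((Real.sqrt (2 * N))⁻¹ : ℝ) : ℂ) * (x.1 + x.2 * Complex.I)‖ ^ 2 =
      (1 / (2 * N)) * (x.1 ^ 2 * 1 + 1 * x.2 ^ 2) := by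
    intro x
    rw [norm_mul, mul_pow, Complex.norm_real, norm_inv, inv_pow, Real.norm_eq_abs, sq_abs,
      Real.sq_sqrt (by positivity), ← Complex.normSq_eq_norm_sq, Complex.normSq_add_mul_I]
    ring
  simp_rw [h]
  rw [integral_const_mul, integral_add, integral_prod_mul (fun x : ℝ => x ^ 2) (fun _ : ℝ => (1 : ℝ)),
    integral_prod_mul (fun _ : ℝ => (1 : ℝ)) (fun x : ℝ => x ^ 2), integral_sq_gaussianReal]
  · simp
    field_simp
    norm_num
  · exact (integrable_pow_gaussianReal 2).mul_prod (integrable_const _)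
  · exact (integrable_const (1 : ℝ)).mul_prod (integrable_pow_gaussianReal 2)

/-- Not sharp: `(a + b)² ≤ 2 (a² + b²)` avoids the cross term, and any bound of order `N⁻²` would
lead to an absolute constant. -/
theorem integral_norm_pow_four_entry_le {N : ℕ} (i j : Fin N) :
    ∫ A, ‖A i j‖ ^ 4 ∂gaussianMatrix N ≤ 3 / N ^ 2 := by
  have hN : (0 : ℝ) < N := by exact_mod_cast i.pos
  rw [integral_entry_gaussianMatrix (fun z => ‖z‖ ^ 4) (by fun_prop)]
  have h : ∀ x : ℝ × ℝ, ‖(((Real.sqrt (2 * N))⁻¹ : ℝ) : ℂ) * (x.1 + x.2 * Complex.I)‖ ^ 4 ≤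
      (1 / (2 * N ^ 2)) * (x.1 ^ 4 * 1 + 1 * x.2 ^ 4) := by
    intro x
    rw [show 4 = 2 * 2 by norm_num, pow_mul, norm_mul, mul_pow, Complex.norm_real, norm_inv,
      inv_pow, Real.norm_eq_abs, sq_abs, Real.sq_sqrt (by positivity),
      ← Complex.normSq_eq_norm_sq, Complex.normSq_add_mul_I]
    have h1 : (x.1 ^ 2 + x.2 ^ 2) ^ 2 ≤ 2 * (x.1 ^ 4 + x.2 ^ 4) := by
      nlinarith [sq_nonneg (x.1 ^ 2 - x.2 ^ 2)]
    calc ((2 * (N : ℝ))⁻¹ * (x.1 ^ 2 + x.2 ^ 2)) ^ 2 =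
        (1 / (4 * N ^ 2)) * (x.1 ^ 2 + x.2 ^ 2) ^ 2 := by field_simp; ring
      _ ≤ (1 / (4 * N ^ 2)) * (2 * (x.1 ^ 4 + x.2 ^ 4)) := by gcongr
      _ = _ := by field_simp; ring
  have hi1 : Integrable (fun x : ℝ × ℝ => x.1 ^ 4 * 1)
      ((gaussianReal 0 1).prod (gaussianReal 0 1)) :=
    (integrable_pow_gaussianReal 4).mul_prod (integrable_const _)
  have hi2 : Integrable (fun x : ℝ × ℝ => 1 * x.2 ^ 4)
      ((gaussianReal 0 1).prod (gaussianReal 0 1)) :=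
    (integrable_const (1 : ℝ)).mul_prod (integrable_pow_gaussianReal 4)
  refine (integral_mono_of_nonneg (Filter.Eventually.of_forall fun x => by positivity)
    ((hi1.add hi2).const_mul _) (Filter.Eventually.of_forall h)).trans (le_of_eq ?_)
  rw [integral_const_mul, integral_add' hi1 hi2,
    integral_prod_mul (fun x : ℝ => x ^ 4) (fun _ : ℝ => (1 : ℝ)),
    integral_prod_mul (fun _ : ℝ => (1 : ℝ)) (fun x : ℝ => x ^ 4), integral_pow_four_gaussianReal]
  simp
  field_simp
  norm_num

theorem memLp_entry_gaussianMatrix {N : ℕ} (i j : Fin N) (p : ℝ≥0∞) (hp : p ≠ ∞) :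
    MemLp (fun A => A i j) p (gaussianMatrix N) := by
  rw [gaussianMatrix_eq_map_stdGaussian, memLp_map_measure_iff
    (measurable_entry i j).aestronglyMeasurable (measurable_scaledMatrix N).aemeasurable]
  have h := (IsGaussian.memLp_id (stdGaussian (EuclideanSpace ℂ (Fin N × Fin N))) p hp).const_smul
    ((Real.sqrt (2 * N))⁻¹)
  refine h.of_le ((measurable_entry i j).comp (measurable_scaledMatrix N)).aestronglyMeasurable
    (Filter.Eventually.of_forall fun v => ?_)
  simp only [Function.comp_apply, scaledMatrix_apply, Pi.smul_apply, id_eq, norm_smul, norm_mul,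
    Complex.norm_real]
  gcongr
  exact PiLp.norm_apply_le v (i, j)

end Moments

/-! ### Linear maps invariant or equivariant under unitary conjugation -/

section Commutant

theorem exists_perm_apply_eq {α : Type*} [DecidableEq α] {i j k l : α} (hij : i ≠ j) (hkl : k ≠ l) :
    ∃ σ : Equiv.Perm α, σ k = i ∧ σ l = j := by
  have h1 : Equiv.swap i k l ≠ i := by
    intro h
    apply hkl
    have := congrArg (Equiv.swap i k) h
    rw [Equiv.swap_apply_self, Equiv.swap_apply_left] at this
    exact this.symm
  refine ⟨Equiv.swap (Equiv.swap i k l) j * Equiv.swap i k, ?_, ?_⟩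
  · rw [Equiv.Perm.mul_apply, Equiv.swap_apply_right, Equiv.swap_apply_of_ne_of_ne h1.symm hij]
  · rw [Equiv.Perm.mul_apply, Equiv.swap_apply_left]

variable {m : Type*} [Fintype m] [DecidableEq m]

/-- The off-diagonal matrix units and the differences of diagonal ones span the matrices of trace
zero. -/
theorem linearMap_eq_zero_of_trace_eq_zero {M : Type*} [AddCommGroup M] [Module ℂ M]
    (G : Matrix m m ℂ →ₗ[ℂ] M) (h1 : ∀ i j, i ≠ j → G (Matrix.single i j 1) = 0)
    (h2 : ∀ i j, G (Matrix.single i i 1) = G (Matrix.single j j 1)) {ξ : Matrix m m ℂ}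
    (hξ : ξ.trace = 0) : G ξ = 0 := by
  rcases isEmpty_or_nonempty m with hm | ⟨⟨k⟩⟩
  · rw [Subsingleton.elim ξ 0, map_zero]
  have hs : ∀ i j, G (Matrix.single i j (ξ i j)) = ξ i j • G (Matrix.single i j 1) := by
    intro i j
    rw [← map_smul, Matrix.smul_single, smul_eq_mul, mul_one]
  conv_lhs => rw [Matrix.matrix_eq_sum_single ξ]
  simp only [map_sum, hs]
  have : ∀ i, ∑ j, ξ i j • G (Matrix.single i j 1) = ξ i i • G (Matrix.single k k 1) := by
    intro i
    rw [Finset.sum_eq_single i (fun j _ hj => by rw [h1 i j hj.symm, smul_zero]) (by simp), h2 i k]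
  simp only [this, ← Finset.sum_smul]
  change ξ.trace • _ = _
  rw [hξ, zero_smul]

theorem diagonal_mem_unitaryGroup {d : m → ℂ} (hd : ∀ i, ‖d i‖ = 1) :
    Matrix.diagonal d ∈ Matrix.unitaryGroup m ℂ := by
  rw [Matrix.mem_unitaryGroup_iff, Matrix.star_eq_conjTranspose, Matrix.diagonal_conjTranspose,
    Matrix.diagonal_mul_diagonal, ← Matrix.diagonal_one]
  congr 1
  ext i
  have := Complex.mul_conj' (d i)
  rw [hd, starRingEnd_apply] at this
  simpa using this

theorem diagonal_conj_apply (d : m → ℂ) (X : Matrix m m ℂ) (a b : m) :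
    (Matrix.diagonal d * X * star (Matrix.diagonal d)) a b = d a * star (d b) * X a b := by
  rw [Matrix.star_eq_conjTranspose, Matrix.diagonal_conjTranspose, Matrix.mul_diagonal,
    Matrix.diagonal_mul, Pi.star_apply]
  ring

theorem diagonal_conj_single (d : m → ℂ) (i j : m) :
    Matrix.diagonal d * Matrix.single i j 1 * star (Matrix.diagonal d) =
      (d i * star (d j)) • Matrix.single i j (1 : ℂ) := by
  ext a b
  rw [diagonal_conj_apply, Matrix.smul_apply, Matrix.single_apply, smul_eq_mul]
  split_ifs with h
  · rw [h.1, h.2]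
  · simp

/-- The permutation matrix of `σ`, as a unitary matrix. -/
theorem submatrix_one_mem_unitaryGroup (σ : Equiv.Perm m) :
    (1 : Matrix m m ℂ).submatrix σ id ∈ Matrix.unitaryGroup m ℂ := by
  rw [Matrix.mem_unitaryGroup_iff, Matrix.star_eq_conjTranspose, Matrix.conjTranspose_submatrix,
    Matrix.conjTranspose_one, ← Matrix.submatrix_mul _ _ _ _ _ Function.bijective_id,
    Matrix.one_mul, Matrix.submatrix_one_equiv]

theorem permutation_conj (σ : Equiv.Perm m) (X : Matrix m m ℂ) :
    (1 : Matrix m m ℂ).submatrix σ id * X * star ((1 : Matrix m m ℂ).submatrix σ id) =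
      X.submatrix σ σ := by
  rw [Matrix.star_eq_conjTranspose, Matrix.conjTranspose_submatrix, Matrix.conjTranspose_one]
  have h : X = X.submatrix id id := rfl
  conv_lhs => rw [h]
  rw [← Matrix.submatrix_mul _ _ _ _ _ Function.bijective_id,
    ← Matrix.submatrix_mul _ _ _ _ _ Function.bijective_id, Matrix.one_mul, Matrix.mul_one]

/-- In the plane of `i` and `j`, the Hadamard matrix `2^(-1/2) [[1, 1], [1, -1]]` diagonalizes the
flip; `V` is this block, completed by the identity. The lemma carries the scalar found on
off-diagonal units over to diagonal differences. -/
theorem exists_unitary_conj_offdiagonal {i j : m} (hij : i ≠ j) :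
    ∃ V ∈ Matrix.unitaryGroup m ℂ,
      V * (Matrix.single i j 1 + Matrix.single j i 1) * star V =
        Matrix.single i i 1 - Matrix.single j j 1 := by
  set P : Matrix m m ℂ := Matrix.single i i 1 + Matrix.single j j 1 with hP
  set K : Matrix m m ℂ := Matrix.single i i 1 + Matrix.single i j 1 + Matrix.single j i 1 -
    Matrix.single j j 1 with hK
  set X : Matrix m m ℂ := Matrix.single i j 1 + Matrix.single j i 1 with hX
  have hPP : P * P = P := by
    simp [hP, mul_add, add_mul, Matrix.single_mul_single_of_ne, hij, hij.symm]
  have hPK : P * K = K := by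
    simp [hP, hK, mul_add, add_mul, mul_sub, Matrix.single_mul_single_of_ne, hij, hij.symm]
  have hKP : K * P = K := by
    simp [hP, hK, mul_add, add_mul, sub_mul, Matrix.single_mul_single_of_ne, hij, hij.symm]
    abel
  have hKK : K * K = (2 : ℂ) • P := by
    simp [hP, hK, mul_add, add_mul, sub_mul, mul_sub, Matrix.single_mul_single_of_ne, hij,
      hij.symm, two_smul]
    abel
  have hPX : P * X = X := by
    simp [hP, hX, mul_add, add_mul, Matrix.single_mul_single_of_ne, hij, hij.symm]
  have hXP : X * P = X := by
    simp [hP, hX, mul_add, add_mul, Matrix.single_mul_single_of_ne, hij, hij.symm]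
    abel
  have hKXK : K * X * K = (2 : ℂ) • (Matrix.single i i 1 - Matrix.single j j 1) := by
    simp [hK, hX, mul_add, add_mul, sub_mul, mul_sub, Matrix.single_mul_single_of_ne, hij,
      hij.symm, two_smul]
    abel
  have hPs : star P = P := by
    simp [hP, Matrix.star_eq_conjTranspose, Matrix.conjTranspose_single]
  have hKs : star K = K := by
    simp [hK, Matrix.star_eq_conjTranspose, Matrix.conjTranspose_single]
    abel
  have hVs : star (1 - P + invSqrtTwo • K) = 1 - P + invSqrtTwo • K := by
    rw [star_add, star_sub, star_one, hPs, star_smul, hKs, ← starRingEnd_apply, conj_invSqrtTwo]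
  refine ⟨1 - P + invSqrtTwo • K, ?_, ?_⟩
  · rw [Matrix.mem_unitaryGroup_iff, hVs]
    simp only [mul_add, add_mul, mul_sub, sub_mul, mul_one, one_mul, Matrix.smul_mul,
      Matrix.mul_smul, hPP, hPK, hKP, hKK, smul_smul]
    rw [← mul_assoc, invSqrtTwo_mul_self]
    norm_num
  · rw [hVs]
    have h1 : (1 - P + invSqrtTwo • K) * X = invSqrtTwo • (K * X) := by
      rw [add_mul, sub_mul, one_mul, hPX, sub_self, zero_add, Matrix.smul_mul]
    rw [h1, mul_add, mul_sub, mul_one, Matrix.smul_mul, Matrix.mul_assoc, hXP, sub_self, zero_add,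
      Matrix.mul_smul, Matrix.smul_mul, hKXK, smul_smul, smul_smul, invSqrtTwo_mul_self]
    norm_num

/-- A linear map on matrices that is invariant under unitary conjugation vanishes on matrices of
trace zero. -/
theorem eq_zero_of_conj_invariant {M : Type*} [AddCommGroup M] [Module ℂ M]
    (S : Matrix m m ℂ →ₗ[ℂ] M)
    (hS : ∀ V ∈ Matrix.unitaryGroup m ℂ, ∀ ξ, S (V * ξ * star V) = S ξ) {ξ : Matrix m m ℂ}
    (hξ : ξ.trace = 0) : S ξ = 0 := by
  refine linearMap_eq_zero_of_trace_eq_zero S (fun i j hij => ?_) (fun i j => ?_) hξ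
  -- Conjugation by this sign matrix negates the unit at `(i, j)`, so `S` must kill it.
  · let d : m → ℂ := fun k => if k = i then -1 else 1
    have hd : ∀ k, ‖d k‖ = 1 := fun k => by simp only [d]; split_ifs <;> simp
    have h := hS _ (diagonal_mem_unitaryGroup hd) (Matrix.single i j 1)
    rw [diagonal_conj_single, map_smul] at h
    simp only [d, if_true, if_neg hij.symm, star_one, mul_one, neg_smul, one_smul] at h
    have h2 : (2 : ℂ) • S (Matrix.single i j 1) = 0 := by
      rw [two_smul]
      nth_rewrite 1 [← h]
      exact neg_add_cancel _
    exact (smul_eq_zero.1 h2).resolve_left two_ne_zero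
  · have h := hS _ (submatrix_one_mem_unitaryGroup (Equiv.swap i j)) (Matrix.single i i 1)
    rw [permutation_conj] at h
    rw [← h]
    congr 1
    ext a b
    simp only [Matrix.submatrix_apply, Matrix.single_apply]
    have : ∀ a, i = Equiv.swap i j a ↔ j = a := fun a => by
      rw [eq_comm, Equiv.swap_apply_eq_iff, Equiv.swap_apply_left, eq_comm]
    simp only [this]

/-- A linear map on matrices that commutes with unitary conjugation is a scalar on matrices of
trace zero. -/
theorem exists_eq_smul_of_conj_equivariant (T : Matrix m m ℂ →ₗ[ℂ] Matrix m m ℂ)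
    (hT : ∀ V ∈ Matrix.unitaryGroup m ℂ, ∀ ξ, T (V * ξ * star V) = V * T ξ * star V) :
    ∃ c : ℂ, ∀ ξ : Matrix m m ℂ, ξ.trace = 0 → T ξ = c • ξ := by
  have hoff : ∀ i j, i ≠ j → ∀ a b, ¬ (i = a ∧ j = b) → T (Matrix.single i j 1) a b = 0 := by
    intro i j hij a b hab
    -- The image of the unit at `(i, j)` must have the same weight under diagonal unitaries. A phase
    -- `√-1` at the single index `j` (if `i = a`) or `i` (otherwise) separates that weight from the
    -- one at `(a, b)`.
    have key : ∀ d : m → ℂ, (∀ k, ‖d k‖ = 1) → (d i * star (d j) - d a * star (d b)) *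
        T (Matrix.single i j 1) a b = 0 := by
      intro d hd
      have h := congrFun (congrFun
        (hT _ (diagonal_mem_unitaryGroup hd) (Matrix.single i j 1)) a) b
      rw [diagonal_conj_single, map_smul, diagonal_conj_apply, Matrix.smul_apply, smul_eq_mul] at h
      rw [sub_mul, h, sub_self]
    have hd : ∀ l k : m, ‖(if k = l then Complex.I else 1)‖ = 1 := fun l k => by
      split_ifs <;> simp
    have hI1 : Complex.I - 1 ≠ 0 := by
      intro h; have := congrArg Complex.re h; norm_num at this
    have hI2 : Complex.I + Complex.I ≠ 0 := by
      intro h; have := congrArg Complex.im h; norm_num at this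
    have hI3 : -Complex.I - 1 ≠ 0 := by
      intro h; have := congrArg Complex.re h; norm_num at this
    have hI4 : -Complex.I - Complex.I ≠ 0 := by
      intro h; have := congrArg Complex.im h; norm_num at this
    by_cases hia : i = a
    · have hjb : b ≠ j := fun h => hab ⟨hia, h.symm⟩
      have h := key _ (hd j)
      have haj : a ≠ j := hia ▸ hij
      simp only [if_neg hij, if_true, if_neg hjb, if_neg haj, Complex.star_def, Complex.conj_I,
        map_one, one_mul] at h
      exact (mul_eq_zero.1 h).resolve_left hI3
    · have h := key _ (hd i)
      simp only [if_neg hij.symm, if_true, if_neg (Ne.symm hia)] at h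
      by_cases hbi : b = i
      · simp only [hbi, if_true, Complex.star_def, Complex.conj_I, map_one, one_mul, mul_one,
          sub_neg_eq_add] at h
        exact hbi ▸ (mul_eq_zero.1 h).resolve_left hI2
      · simp only [if_neg hbi, Complex.star_def, map_one, mul_one] at h
        exact (mul_eq_zero.1 h).resolve_left hI1
  have hoff' : ∀ i j, i ≠ j → T (Matrix.single i j 1) =
      T (Matrix.single i j 1) i j • Matrix.single i j 1 := by
    intro i j hij
    ext a b
    rw [Matrix.smul_apply, Matrix.single_apply]
    split_ifs with h
    · simp [h.1, h.2]
    · simp [hoff i j hij a b h]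
  -- Permutation matrices act transitively on pairs of distinct indices, so the eigenvalue is the
  -- same for all off-diagonal units.
  have hperm : ∀ i j k l, i ≠ j → k ≠ l →
      T (Matrix.single i j 1) i j = T (Matrix.single k l 1) k l := by
    intro i j k l hij hkl
    obtain ⟨σ, hk, hl⟩ := exists_perm_apply_eq hij hkl
    have h := congrFun (congrFun
      (hT _ (submatrix_one_mem_unitaryGroup σ) (Matrix.single i j 1)) k) l
    rw [permutation_conj, permutation_conj, Matrix.submatrix_apply, hk, hl] at h
    have hs : (Matrix.single i j (1 : ℂ)).submatrix σ σ = Matrix.single k l 1 := by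
      ext a b
      simp only [Matrix.submatrix_apply, Matrix.single_apply, ← hk, ← hl,
        EmbeddingLike.apply_eq_iff_eq]
    rw [← h, hs]
  obtain ⟨c, hc⟩ : ∃ c : ℂ, ∀ i j, i ≠ j → T (Matrix.single i j 1) = c • Matrix.single i j 1 := by
    by_cases h : ∃ i j : m, i ≠ j
    · obtain ⟨i, j, hij⟩ := h
      refine ⟨T (Matrix.single i j 1) i j, fun k l hkl => ?_⟩
      rw [hoff' k l hkl, hperm i j k l hij hkl]
    · push Not at h
      exact ⟨0, fun i j hij => absurd (h i j) hij⟩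
  refine ⟨c, fun ξ hξ => ?_⟩
  have h := linearMap_eq_zero_of_trace_eq_zero (T - c • LinearMap.id) (fun i j hij => ?_)
    (fun i j => ?_) hξ
  · simpa [sub_eq_zero] using h
  · simp [hc i j hij]
  · by_cases hij : i = j
    · rw [hij]
    · obtain ⟨V, hV, hVX⟩ := exists_unitary_conj_offdiagonal hij
      have h := hT V hV (Matrix.single i j 1 + Matrix.single j i 1)
      rw [hVX, map_add T (Matrix.single i j 1), hc i j hij, hc j i (Ne.symm hij), ← smul_add,
        Matrix.mul_smul, Matrix.smul_mul, hVX] at h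
      rw [← sub_eq_zero, ← map_sub]
      simp [h]

end Commutant

/-! ### The maps `ξ ↦ 𝔼 Y ξ Y*` and `ξ ↦ 𝔼 |Y| ξ |Y|`, and the fourth moment of `Y` -/

section Averages

open scoped MatrixOrder ComplexOrder

variable {N : ℕ}

theorem measurable_cfcAbs : Measurable (CFC.abs : Matrix (Fin N) (Fin N) ℂ → _) := by
  have h : Continuous (CFC.abs : Matrix (Fin N) (Fin N) ℂ → Matrix (Fin N) (Fin N) ℂ) := by
    open scoped Matrix.Norms.L2Operator in
    exact CFC.continuous_abs
  exact h.measurable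

theorem conjTranspose_cfcAbs (A : Matrix (Fin N) (Fin N) ℂ) : (CFC.abs A)ᴴ = CFC.abs A :=
  (Matrix.nonneg_iff_posSemidef.1 (CFC.abs_nonneg A)).isHermitian

theorem measurable_star_entry (i j : Fin N) :
    Measurable fun A : Matrix (Fin N) (Fin N) ℂ => star (A i j) :=
  continuous_star.measurable.comp (measurable_entry i j)

theorem cfcAbs_unitary_conj {V : Matrix (Fin N) (Fin N) ℂ}
    (hV : V ∈ Matrix.unitaryGroup (Fin N) ℂ) (A : Matrix (Fin N) (Fin N) ℂ) :
    CFC.abs (V * A * star V) = V * CFC.abs A * star V := by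
  have hV' := Matrix.mem_unitaryGroup_iff'.1 hV
  rw [CFC.abs]
  refine CFC.sqrt_unique ?_ ?_
  · calc V * CFC.abs A * star V * (V * CFC.abs A * star V) =
        V * CFC.abs A * (star V * V) * CFC.abs A * star V := by simp only [Matrix.mul_assoc]
      _ = V * (CFC.abs A * CFC.abs A) * star V := by
        rw [hV', Matrix.mul_one]; simp only [Matrix.mul_assoc]
      _ = V * star A * (star V * V) * A * star V := by
        rw [hV', CFC.abs_mul_abs, Matrix.mul_one]; simp only [Matrix.mul_assoc]
      _ = _ := by simp only [star_mul, star_star, Matrix.mul_assoc]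
  · exact star_right_conjugate_nonneg (CFC.abs_nonneg A) V

theorem sum_norm_sq_cfcAbs (A : Matrix (Fin N) (Fin N) ℂ) :
    ∑ i, ∑ j, ‖CFC.abs A i j‖ ^ 2 = ∑ i, ∑ j, ‖A i j‖ ^ 2 := by
  have h := sum_norm_sq_eq_trace (CFC.abs A)
  rw [conjTranspose_cfcAbs, CFC.abs_mul_abs, Matrix.star_eq_conjTranspose,
    ← sum_norm_sq_eq_trace] at h
  exact_mod_cast h

theorem norm_sq_cfcAbs_entry_le (A : Matrix (Fin N) (Fin N) ℂ) (i j : Fin N) :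
    ‖CFC.abs A i j‖ ^ 2 ≤ ∑ i, ∑ j, ‖A i j‖ ^ 2 := by
  rw [← sum_norm_sq_cfcAbs]
  refine (Finset.single_le_sum (f := fun j => ‖CFC.abs A i j‖ ^ 2) (fun _ _ => by positivity)
    (Finset.mem_univ j)).trans ?_
  exact Finset.single_le_sum (f := fun i => ∑ j, ‖CFC.abs A i j‖ ^ 2)
    (fun _ _ => Finset.sum_nonneg fun _ _ => by positivity) (Finset.mem_univ i)

theorem integrable_norm_sq_entry (i j : Fin N) :
    Integrable (fun A => ‖A i j‖ ^ 2) (gaussianMatrix N) :=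
  (memLp_entry_gaussianMatrix i j 2 (by simp)).integrable_norm_pow (by simp)

theorem integrable_norm_pow_four_entry (i j : Fin N) :
    Integrable (fun A => ‖A i j‖ ^ 4) (gaussianMatrix N) :=
  (memLp_entry_gaussianMatrix i j 4 (by simp)).integrable_norm_pow (by simp)

theorem integrable_sum_norm_sq :
    Integrable (fun A => ∑ i, ∑ j, ‖A i j‖ ^ 2) (gaussianMatrix N) :=
  integrable_finsetSum _ fun i _ => integrable_finsetSum _ fun j _ => integrable_norm_sq_entry i j

theorem integral_sum_norm_sq :
    ∫ A, ∑ i, ∑ j, ‖A i j‖ ^ 2 ∂gaussianMatrix N = N := by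
  rw [integral_finsetSum _ fun i _ => integrable_finsetSum _ fun j _ =>
    integrable_norm_sq_entry i j]
  simp_rw [integral_finsetSum _ fun j _ => integrable_norm_sq_entry _ j, integral_norm_sq_entry]
  rcases Nat.eq_zero_or_pos N with h | h
  · subst h; simp
  · have : (N : ℝ) ≠ 0 := by positivity
    simp [this]

theorem integrable_mul_entry (a k b l : Fin N) :
    Integrable (fun A => A a k * star (A b l)) (gaussianMatrix N) := by
  refine integrable_sum_norm_sq.mono'
    ((measurable_entry a k).mul (measurable_star_entry b l)).aestronglyMeasurable
    (Filter.Eventually.of_forall fun A => ?_)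
  rw [norm_mul, norm_star]
  have h : ∀ i j, ‖A i j‖ ^ 2 ≤ ∑ i, ∑ j, ‖A i j‖ ^ 2 := fun i j =>
    (Finset.single_le_sum (f := fun j => ‖A i j‖ ^ 2) (fun _ _ => by positivity)
      (Finset.mem_univ j)).trans (Finset.single_le_sum (f := fun i => ∑ j, ‖A i j‖ ^ 2)
        (fun _ _ => Finset.sum_nonneg fun _ _ => by positivity) (Finset.mem_univ i))
  nlinarith [h a k, h b l, two_mul_le_add_sq ‖A a k‖ ‖A b l‖]

theorem integrable_mul_cfcAbs_entry (a k b l : Fin N) :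
    Integrable (fun A : Matrix (Fin N) (Fin N) ℂ => CFC.abs A a k * star (CFC.abs A b l))
      (gaussianMatrix N) := by
  refine integrable_sum_norm_sq.mono'
    (((measurable_entry a k).comp measurable_cfcAbs).mul
      ((measurable_star_entry b l).comp measurable_cfcAbs)).aestronglyMeasurable
    (Filter.Eventually.of_forall fun A => ?_)
  rw [norm_mul, norm_star]
  nlinarith [norm_sq_cfcAbs_entry_le A a k, norm_sq_cfcAbs_entry_le A b l,
    two_mul_le_add_sq ‖CFC.abs A a k‖ ‖CFC.abs A b l‖]

/-- The linear map `ξ ↦ 𝔼 (F ξ F*)` for a random matrix `F`. -/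
noncomputable def averageConj {α : Type*} [MeasurableSpace α] (μ : Measure α)
    (F : α → Matrix (Fin N) (Fin N) ℂ) : Matrix (Fin N) (Fin N) ℂ →ₗ[ℂ] Matrix (Fin N) (Fin N) ℂ where
  toFun ξ := Matrix.of fun a b => ∑ k, ∑ l, ξ k l * ∫ x, F x a k * star (F x b l) ∂μ
  map_add' ξ η := by
    ext a b
    simp [add_mul, Finset.sum_add_distrib]
  map_smul' c ξ := by
    ext a b
    simp [Finset.mul_sum, mul_assoc]

theorem mul_mul_conjTranspose_apply (F ξ : Matrix (Fin N) (Fin N) ℂ) (a b : Fin N) :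
    (F * ξ * Fᴴ) a b = ∑ k, ∑ l, ξ k l * (F a k * star (F b l)) := by
  simp only [Matrix.mul_apply, Matrix.conjTranspose_apply, Finset.sum_mul]
  rw [Finset.sum_comm]
  refine Finset.sum_congr rfl fun k _ => Finset.sum_congr rfl fun l _ => ?_
  ring

variable {α : Type*} [MeasurableSpace α] {μ : Measure α} {F : α → Matrix (Fin N) (Fin N) ℂ}

theorem averageConj_apply (hF : ∀ a k b l, Integrable (fun x => F x a k * star (F x b l)) μ)
    (ξ : Matrix (Fin N) (Fin N) ℂ) (a b : Fin N) :
    averageConj μ F ξ a b = ∫ x, (F x * ξ * (F x)ᴴ) a b ∂μ := by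
  change (∑ k, ∑ l, ξ k l * ∫ x, F x a k * star (F x b l) ∂μ) = _
  simp_rw [mul_mul_conjTranspose_apply]
  rw [integral_finsetSum _ fun k _ => integrable_finsetSum _ fun l _ => (hF a k b l).const_mul (ξ k l)]
  refine Finset.sum_congr rfl fun k _ => ?_
  rw [integral_finsetSum _ fun l _ => (hF a k b l).const_mul (ξ k l)]
  simp_rw [integral_const_mul]

theorem integrable_mul_mul_conjTranspose
    (hF : ∀ a k b l, Integrable (fun x => F x a k * star (F x b l)) μ)
    (ξ : Matrix (Fin N) (Fin N) ℂ) (a b : Fin N) :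
    Integrable (fun x => (F x * ξ * (F x)ᴴ) a b) μ := by
  simp_rw [mul_mul_conjTranspose_apply]
  exact integrable_finsetSum _ fun k _ => integrable_finsetSum _ fun l _ => (hF a k b l).const_mul _

theorem integral_conj_apply {G : α → Matrix (Fin N) (Fin N) ℂ}
    (hG : ∀ a b, Integrable (fun x => G x a b) μ) (V : Matrix (Fin N) (Fin N) ℂ) (a b : Fin N) :
    ∫ x, (V * G x * Vᴴ) a b ∂μ = (V * (Matrix.of fun a b => ∫ x, G x a b ∂μ) * Vᴴ) a b := by
  simp_rw [mul_mul_conjTranspose_apply]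
  rw [integral_finsetSum _ fun k _ => integrable_finsetSum _ fun l _ => (hG k l).mul_const _]
  simp_rw [integral_finsetSum _ fun l _ => (hG _ l).mul_const _, integral_mul_const]
  rfl

/-- Since `Y V*` has the law of `Y`, the map does not change when its argument is conjugated by `V`.
This is the centering that permits symmetrization. -/
theorem averageConj_gaussian_eq_zero {ξ : Matrix (Fin N) (Fin N) ℂ} (hξ : ξ.trace = 0) :
    averageConj (gaussianMatrix N) (fun A => A) ξ = 0 := by
  refine eq_zero_of_conj_invariant _ (fun V hV ξ => ?_) hξ
  ext a b
  rw [averageConj_apply integrable_mul_entry, averageConj_apply integrable_mul_entry]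
  have hm : Measurable fun A : Matrix (Fin N) (Fin N) ℂ => A * star V :=
    Continuous.measurable (by fun_prop)
  conv_lhs => rw [← gaussianMatrix_map_mul_right (Unitary.star_mem hV)]
  have hm2 : Measurable fun A : Matrix (Fin N) (Fin N) ℂ =>
      (A * (V * ξ * star V) * Aᴴ) a b :=
    (measurable_entry a b).comp (Continuous.measurable (by fun_prop))
  rw [integral_map hm.aemeasurable hm2.aestronglyMeasurable]
  refine integral_congr_ae (Filter.Eventually.of_forall fun A => ?_)
  have hV' := Matrix.mem_unitaryGroup_iff'.1 hV
  have : A * star V * (V * ξ * star V) * (A * star V)ᴴ = A * ξ * Aᴴ := by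
    calc _ = A * (star V * V) * ξ * (star V * V) * Aᴴ := by
          simp [Matrix.star_eq_conjTranspose, Matrix.mul_assoc]
      _ = _ := by rw [hV', Matrix.mul_one, Matrix.mul_one]
  simp only [this]

/-- `V Y V*` has the law of `Y`, and its absolute value is `V |Y| V*`. -/
theorem averageConj_cfcAbs_equivariant {V : Matrix (Fin N) (Fin N) ℂ}
    (hV : V ∈ Matrix.unitaryGroup (Fin N) ℂ) (ξ : Matrix (Fin N) (Fin N) ℂ) :
    averageConj (gaussianMatrix N) CFC.abs (V * ξ * star V) =
      V * averageConj (gaussianMatrix N) CFC.abs ξ * star V := by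
  ext a b
  rw [averageConj_apply integrable_mul_cfcAbs_entry]
  have hm : Measurable fun A : Matrix (Fin N) (Fin N) ℂ => V * A * star V :=
    Continuous.measurable (by fun_prop)
  have hmap : (gaussianMatrix N).map (fun A => V * A * star V) = gaussianMatrix N := by
    conv_rhs => rw [← gaussianMatrix_map_mul_right (Unitary.star_mem hV),
      ← gaussianMatrix_map_mul_left hV]
    rw [Measure.map_map (Continuous.measurable (by fun_prop)) (Continuous.measurable (by fun_prop))]
    rfl
  have hm2 : Measurable fun A : Matrix (Fin N) (Fin N) ℂ =>
      (CFC.abs A * (V * ξ * star V) * (CFC.abs A)ᴴ) a b := by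
    have : Measurable fun A : Matrix (Fin N) (Fin N) ℂ => (A * (V * ξ * star V) * Aᴴ) :=
      Continuous.measurable (by fun_prop)
    exact (measurable_entry a b).comp (this.comp measurable_cfcAbs)
  conv_lhs => rw [← hmap]
  rw [integral_map hm.aemeasurable hm2.aestronglyMeasurable]
  have hV' := Matrix.mem_unitaryGroup_iff'.1 hV
  have h : ∀ A : Matrix (Fin N) (Fin N) ℂ, CFC.abs (V * A * star V) * (V * ξ * star V) *
      (CFC.abs (V * A * star V))ᴴ = V * (CFC.abs A * ξ * (CFC.abs A)ᴴ) * Vᴴ := by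
    intro A
    rw [cfcAbs_unitary_conj hV]
    calc _ = V * CFC.abs A * (star V * V) * ξ * (star V * V) * (CFC.abs A)ᴴ * Vᴴ := by
          simp [Matrix.star_eq_conjTranspose, Matrix.mul_assoc]
      _ = _ := by rw [hV', Matrix.mul_one, Matrix.mul_one]; simp only [Matrix.mul_assoc]
  simp_rw [h]
  rw [integral_conj_apply (integrable_mul_mul_conjTranspose integrable_mul_cfcAbs_entry ξ),
    Matrix.star_eq_conjTranspose]
  have hT : averageConj (gaussianMatrix N) CFC.abs ξ = Matrix.of fun a b =>
      ∫ A : Matrix (Fin N) (Fin N) ℂ, (CFC.abs A * ξ * (CFC.abs A)ᴴ) a b ∂gaussianMatrix N := by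
    ext a b
    rw [averageConj_apply integrable_mul_cfcAbs_entry]
    rfl
  rw [hT]

/-- The singular values of `A` in terms of traces. -/
theorem exists_singularValues (A : Matrix (Fin N) (Fin N) ℂ) :
    ∃ s : Fin N → ℝ, (∀ i, 0 ≤ s i) ∧ (CFC.abs A).trace = ((∑ i, s i : ℝ) : ℂ) ∧
      ∑ i, ∑ j, ‖A i j‖ ^ 2 = ∑ i, s i ^ 2 ∧
      ∑ i, ∑ j, ‖(Aᴴ * A) i j‖ ^ 2 = ∑ i, s i ^ 4 := by
  obtain ⟨W, hW, V, hV, s, hs, hA, hR, -⟩ := exists_svd A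
  have hV' := Matrix.mem_unitaryGroup_iff'.1 hV
  have hsq : Aᴴ * A = V * Matrix.diagonal (fun i => ((s i ^ 2 : ℝ) : ℂ)) * star V := by
    rw [← Matrix.star_eq_conjTranspose, ← CFC.abs_mul_abs, hR]
    calc _ = V * Matrix.diagonal (fun i => (s i : ℂ)) * (star V * V) *
          Matrix.diagonal (fun i => (s i : ℂ)) * star V := by simp only [Matrix.mul_assoc]
      _ = V * (Matrix.diagonal (fun i => (s i : ℂ)) * Matrix.diagonal (fun i => (s i : ℂ))) *
          star V := by rw [hV', Matrix.mul_one]; simp only [Matrix.mul_assoc]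
      _ = _ := by simp [Matrix.diagonal_mul_diagonal, sq]
  refine ⟨s, hs, ?_, ?_, ?_⟩
  · rw [hR, trace_unitary_conj hV, Matrix.trace_diagonal, Complex.ofReal_sum]
  · have h := sum_norm_sq_eq_trace A
    rw [hsq, trace_unitary_conj hV, Matrix.trace_diagonal, ← Complex.ofReal_sum] at h
    exact_mod_cast h
  · have h := sum_norm_sq_eq_trace (Aᴴ * A)
    have h2 : (Aᴴ * A)ᴴ * (Aᴴ * A) =
        V * Matrix.diagonal (fun i => ((s i ^ 4 : ℝ) : ℂ)) * star V := by
      rw [Matrix.conjTranspose_mul, Matrix.conjTranspose_conjTranspose, hsq]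
      calc _ = V * Matrix.diagonal (fun i => ((s i ^ 2 : ℝ) : ℂ)) * (star V * V) *
            Matrix.diagonal (fun i => ((s i ^ 2 : ℝ) : ℂ)) * star V := by
              simp only [Matrix.mul_assoc]
        _ = V * (Matrix.diagonal (fun i => ((s i ^ 2 : ℝ) : ℂ)) *
            Matrix.diagonal (fun i => ((s i ^ 2 : ℝ) : ℂ))) * star V := by
              rw [hV', Matrix.mul_one]; simp only [Matrix.mul_assoc]
        _ = _ := by
          rw [Matrix.diagonal_mul_diagonal]
          congr 3
          ext i
          push_cast
          ring
    rw [h2, trace_unitary_conj hV, Matrix.trace_diagonal, ← Complex.ofReal_sum] at h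
    exact_mod_cast h

theorem norm_mul_four_le (a b c d : ℂ) :
    ‖a * b * (c * d)‖ ≤ (‖a‖ ^ 4 + ‖b‖ ^ 4 + ‖c‖ ^ 4 + ‖d‖ ^ 4) / 4 := by
  rw [norm_mul, norm_mul, norm_mul]
  set x := ‖a‖
  set y := ‖b‖
  set z := ‖c‖
  set w := ‖d‖
  nlinarith [sq_nonneg (x * y - z * w), sq_nonneg (x ^ 2 - y ^ 2), sq_nonneg (z ^ 2 - w ^ 2)]

theorem integrable_mul_four_entry (i j k l : Fin N) :
    Integrable (fun A => star (A i j) * A i l * (A k j * star (A k l))) (gaussianMatrix N) := by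
  refine (((((integrable_norm_pow_four_entry i j).add (integrable_norm_pow_four_entry i l)).add
    (integrable_norm_pow_four_entry k j)).add (integrable_norm_pow_four_entry k l)).div_const
      4).mono' ?_ (Filter.Eventually.of_forall fun A => ?_)
  · exact (((measurable_star_entry i j).mul (measurable_entry i l)).mul
      ((measurable_entry k j).mul (measurable_star_entry k l))).aestronglyMeasurable
  · simpa using norm_mul_four_le (star (A i j)) (A i l) (A k j) (star (A k l))

/-- If `i ≠ k` and `j ≠ l`, the four entries are distinct and a phase on one of them forces the
moment to vanish. Otherwise the arithmetic-geometric mean inequality and the fourth moment of an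
entry give `3 / N²`. -/
theorem norm_integral_mul_four_entry_le (i j k l : Fin N) :
    ‖∫ A, star (A i j) * A i l * (A k j * star (A k l)) ∂gaussianMatrix N‖ ≤
      (if i = k then 3 / (N : ℝ) ^ 2 else 0) + (if j = l then 3 / (N : ℝ) ^ 2 else 0) := by
  by_cases h : i = k ∨ j = l
  · have h1 : ‖∫ A, star (A i j) * A i l * (A k j * star (A k l)) ∂gaussianMatrix N‖ ≤
        3 / (N : ℝ) ^ 2 := by
      refine (norm_integral_le_integral_norm _).trans ?_
      have hi := ((((integrable_norm_pow_four_entry i j).add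
        (integrable_norm_pow_four_entry i l)).add (integrable_norm_pow_four_entry k j)).add
          (integrable_norm_pow_four_entry k l)).div_const 4
      refine (integral_mono_of_nonneg (Filter.Eventually.of_forall fun _ => norm_nonneg _) hi
        (Filter.Eventually.of_forall fun A => ?_)).trans ?_
      · simpa using norm_mul_four_le (star (A i j)) (A i l) (A k j) (star (A k l))
      · simp only [Pi.add_apply]
        rw [integral_div, integral_add, integral_add, integral_add]
        · linarith [integral_norm_pow_four_entry_le i j, integral_norm_pow_four_entry_le i l,
            integral_norm_pow_four_entry_le k j, integral_norm_pow_four_entry_le k l]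
        · exact integrable_norm_pow_four_entry i j
        · exact integrable_norm_pow_four_entry i l
        · exact (integrable_norm_pow_four_entry i j).add (integrable_norm_pow_four_entry i l)
        · exact integrable_norm_pow_four_entry k j
        · exact ((integrable_norm_pow_four_entry i j).add
            (integrable_norm_pow_four_entry i l)).add (integrable_norm_pow_four_entry k j)
        · exact integrable_norm_pow_four_entry k l
    have h0 : (0 : ℝ) ≤ 3 / (N : ℝ) ^ 2 := by positivity
    refine h1.trans ?_
    rcases h with h | h
    · rw [if_pos h]
      split_ifs <;> linarith
    · rw [if_pos h]
      split_ifs <;> linarith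
  · push Not at h
    obtain ⟨hik, hjl⟩ := h
    rw [if_neg hik, if_neg hjl, add_zero]
    let d : Fin N → Fin N → ℂ := fun a b => if a = i ∧ b = j then Complex.I else 1
    have hd : ∀ a b, ‖d a b‖ = 1 := fun a b => by simp only [d]; split_ifs <;> simp
    set Z := ∫ A, star (A i j) * A i l * (A k j * star (A k l)) ∂gaussianMatrix N with hZ
    have hm : Measurable fun A : Matrix (Fin N) (Fin N) ℂ =>
        (Matrix.of fun a b => d a b * A a b : Matrix (Fin N) (Fin N) ℂ) :=
      measurable_matrix_iff.2 fun a b => (measurable_entry a b).const_mul _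
    have hm2 : Measurable fun A : Matrix (Fin N) (Fin N) ℂ =>
        star (A i j) * A i l * (A k j * star (A k l)) :=
      ((measurable_star_entry i j).mul (measurable_entry i l)).mul
        ((measurable_entry k j).mul (measurable_star_entry k l))
    have h1 : Z = -Complex.I * Z := by
      conv_lhs => rw [hZ, ← gaussianMatrix_map_phase d hd]
      rw [integral_map hm.aemeasurable hm2.aestronglyMeasurable, hZ, ← integral_const_mul]
      refine integral_congr_ae (Filter.Eventually.of_forall fun A => ?_)
      simp [d, hjl.symm, Ne.symm hik]
      ring
    have h2 : (1 + Complex.I) * Z = 0 := by linear_combination h1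
    have h3 : 1 + Complex.I ≠ 0 := by
      intro h; have := congrArg Complex.re h; norm_num at this
    rw [(mul_eq_zero.1 h2).resolve_left h3, norm_zero]

theorem norm_sq_gram_eq (A : Matrix (Fin N) (Fin N) ℂ) :
    ((∑ j, ∑ l, ‖(Aᴴ * A) j l‖ ^ 2 : ℝ) : ℂ) =
      ∑ j, ∑ l, ∑ i, ∑ k, star (A i j) * A i l * (A k j * star (A k l)) := by
  push_cast
  refine Finset.sum_congr rfl fun j _ => Finset.sum_congr rfl fun l _ => ?_
  rw [← Complex.mul_conj', Matrix.mul_apply, map_sum, Finset.sum_mul_sum]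
  refine Finset.sum_congr rfl fun i _ => Finset.sum_congr rfl fun k _ => ?_
  simp only [Matrix.conjTranspose_apply, map_mul, starRingEnd_apply, star_star]

theorem integrable_norm_sq_gram :
    Integrable (fun A => ∑ j, ∑ l, ‖(Aᴴ * A) j l‖ ^ 2) (gaussianMatrix N) := by
  have h : Integrable (fun A => ((∑ j, ∑ l, ‖(Aᴴ * A) j l‖ ^ 2 : ℝ) : ℂ)) (gaussianMatrix N) := by
    simp_rw [norm_sq_gram_eq]
    exact integrable_finsetSum _ fun j _ => integrable_finsetSum _ fun l _ =>
      integrable_finsetSum _ fun i _ => integrable_finsetSum _ fun k _ =>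
        integrable_mul_four_entry i j k l
  exact h.re

/-- This is `𝔼 tr (Y*Y)²`. Each of the cases `i = k` and `j = l` contributes `N³` index tuples of
size at most `3 / N²`. -/
theorem integral_norm_sq_gram_le :
    ∫ A, ∑ j, ∑ l, ‖(Aᴴ * A) j l‖ ^ 2 ∂gaussianMatrix N ≤ 6 * N := by
  have h0 : 0 ≤ ∫ A, ∑ j, ∑ l, ‖(Aᴴ * A) j l‖ ^ 2 ∂gaussianMatrix N :=
    integral_nonneg fun A => Finset.sum_nonneg fun _ _ => Finset.sum_nonneg fun _ _ => by positivity
  have h1 : ((∫ A, ∑ j, ∑ l, ‖(Aᴴ * A) j l‖ ^ 2 ∂gaussianMatrix N : ℝ) : ℂ) =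
      ∑ j, ∑ l, ∑ i, ∑ k,
        ∫ A, star (A i j) * A i l * (A k j * star (A k l)) ∂gaussianMatrix N := by
    rw [← integral_complex_ofReal]
    simp_rw [norm_sq_gram_eq]
    rw [integral_finsetSum _ fun j _ => integrable_finsetSum _ fun l _ =>
      integrable_finsetSum _ fun i _ => integrable_finsetSum _ fun k _ =>
        integrable_mul_four_entry i j k l]
    refine Finset.sum_congr rfl fun j _ => ?_
    rw [integral_finsetSum _ fun l _ =>
      integrable_finsetSum _ fun i _ => integrable_finsetSum _ fun k _ =>
        integrable_mul_four_entry i j k l]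
    refine Finset.sum_congr rfl fun l _ => ?_
    rw [integral_finsetSum _ fun i _ => integrable_finsetSum _ fun k _ =>
        integrable_mul_four_entry i j k l]
    refine Finset.sum_congr rfl fun i _ => ?_
    rw [integral_finsetSum _ fun k _ => integrable_mul_four_entry i j k l]
  have h2 := congrArg norm h1
  rw [Complex.norm_of_nonneg h0] at h2
  rw [h2]
  calc _ ≤ ∑ j : Fin N, ∑ l : Fin N, ∑ i : Fin N, ∑ k : Fin N,
        ((if i = k then 3 / (N : ℝ) ^ 2 else 0) + (if j = l then 3 / (N : ℝ) ^ 2 else 0)) := by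
        refine (norm_sum_le _ _).trans (Finset.sum_le_sum fun j _ => ?_)
        refine (norm_sum_le _ _).trans (Finset.sum_le_sum fun l _ => ?_)
        refine (norm_sum_le _ _).trans (Finset.sum_le_sum fun i _ => ?_)
        refine (norm_sum_le _ _).trans (Finset.sum_le_sum fun k _ => ?_)
        exact norm_integral_mul_four_entry_le i j k l
    _ = 6 * (N : ℝ) := by
        rcases Nat.eq_zero_or_pos N with h | h
        · subst h; simp
        · have : (N : ℝ) ≠ 0 := by positivity
          simp [Finset.sum_add_distrib]
          field_simp
          norm_num

end Averages

/-! ### Lower bound for the scalar -/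

section Constant

open scoped MatrixOrder ComplexOrder

variable {N : ℕ}

theorem sum_mul_star_diag_eq (A : Matrix (Fin N) (Fin N) ℂ) :
    ∑ k, ∑ l, A k k * star (A l l) = ((‖A.trace‖ ^ 2 : ℝ) : ℂ) := by
  push_cast
  rw [← Complex.mul_conj', Matrix.trace, map_sum, Finset.sum_mul_sum]
  rfl

theorem integrable_norm_sq_trace_cfcAbs :
    Integrable (fun A : Matrix (Fin N) (Fin N) ℂ => ‖(CFC.abs A).trace‖ ^ 2)
      (gaussianMatrix N) := by
  have h : Integrable (fun A : Matrix (Fin N) (Fin N) ℂ =>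
      ((‖(CFC.abs A).trace‖ ^ 2 : ℝ) : ℂ)) (gaussianMatrix N) := by
    simp_rw [← sum_mul_star_diag_eq]
    exact integrable_finsetSum _ fun k _ => integrable_finsetSum _ fun l _ =>
      integrable_mul_cfcAbs_entry k k l l
  exact h.re

/-- The sum of the squared singular values is at most the square of their sum. This linear bound
serves small `N`, where the quadratic one is too weak. -/
theorem le_integral_norm_sq_trace_cfcAbs :
    (N : ℝ) ≤ ∫ A : Matrix (Fin N) (Fin N) ℂ, ‖(CFC.abs A).trace‖ ^ 2 ∂gaussianMatrix N := by
  rw [← integral_sum_norm_sq]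
  refine integral_mono integrable_sum_norm_sq integrable_norm_sq_trace_cfcAbs fun A => ?_
  obtain ⟨s, hs, h1, h2, -⟩ := exists_singularValues A
  simp only [h1, h2]
  rw [Complex.norm_of_nonneg (Finset.sum_nonneg fun i _ => hs i)]
  exact Finset.sum_sq_le_sq_sum_of_nonneg fun i _ => hs i

/-- For singular values `s`, `s ≥ (3/4) s² - (1/16) s⁴` holds because `s (s - 2)² (s + 4) ≥ 0`, and
`(∑ s)² ≥ 2t ∑ s - t²` is used with `t = 3N/8`. The moments `N` and `6N` then give `(3/4)(3/8) N² -
(9/64) N² = (9/64) N²`. -/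
theorem sq_le_integral_norm_sq_trace_cfcAbs :
    9 / 64 * (N : ℝ) ^ 2 ≤
      ∫ A : Matrix (Fin N) (Fin N) ℂ, ‖(CFC.abs A).trace‖ ^ 2 ∂gaussianMatrix N := by
  have hi := (((integrable_sum_norm_sq (N := N)).const_mul (3 / 4)).sub
    ((integrable_norm_sq_gram (N := N)).const_mul (1 / 16))).const_mul (3 / 4 * (N : ℝ))
  have hmono := integral_mono (hi.sub (integrable_const (9 / 64 * (N : ℝ) ^ 2)))
    integrable_norm_sq_trace_cfcAbs (fun A => by
      obtain ⟨s, hs, h1, h2, h3⟩ := exists_singularValues A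
      simp only [Pi.sub_apply, h1, h2, h3]
      rw [Complex.norm_of_nonneg (Finset.sum_nonneg fun i _ => hs i)]
      have h4 : 3 / 4 * ∑ i, s i ^ 2 - 1 / 16 * ∑ i, s i ^ 4 ≤ ∑ i, s i := by
        rw [Finset.mul_sum, Finset.mul_sum, ← Finset.sum_sub_distrib]
        refine Finset.sum_le_sum fun i _ => ?_
        have h5 : 0 ≤ s i * ((s i - 2) ^ 2 * (s i + 4)) :=
          mul_nonneg (hs i) (mul_nonneg (sq_nonneg _) (by linarith [hs i]))
        nlinarith [h5]
      have h6 : 3 / 4 * (N : ℝ) * (3 / 4 * ∑ i, s i ^ 2 - 1 / 16 * ∑ i, s i ^ 4) ≤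
          3 / 4 * (N : ℝ) * ∑ i, s i := mul_le_mul_of_nonneg_left h4 (by positivity)
      nlinarith [sq_nonneg (∑ i, s i - 3 / 8 * (N : ℝ)), h6])
  refine le_trans ?_ hmono
  rw [integral_sub' hi (integrable_const _), integral_const_mul, integral_sub'
    (integrable_sum_norm_sq.const_mul _) (integrable_norm_sq_gram.const_mul _),
    integral_const_mul, integral_const_mul, integral_sum_norm_sq]
  have hN : (0 : ℝ) ≤ N := by positivity
  have := mul_le_mul_of_nonneg_left (integral_norm_sq_gram_le (N := N)) hN
  simp
  nlinarith

/-- The map `ξ ↦ 𝔼 (|Y| ξ |Y|)` is a scalar, bounded below by an absolute constant, on the matrices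
of trace zero. -/
theorem exists_averageConj_cfcAbs_eq_smul (N : ℕ) :
    ∃ c : ℂ, 1 / 12 ≤ ‖c‖ ∧ ∀ ξ : Matrix (Fin N) (Fin N) ℂ, ξ.trace = 0 →
      averageConj (gaussianMatrix N) CFC.abs ξ = c • ξ := by
  rcases Nat.lt_or_ge N 2 with hN | hN
  -- For `N ≤ 1` the only matrix of trace zero is `0`, so any scalar works; below, `N² - 1 > 0`.
  · refine ⟨1, by norm_num, fun ξ hξ => ?_⟩
    have : ξ = 0 := by
      interval_cases N
      · exact Subsingleton.elim _ _
      · ext i j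
        rw [Subsingleton.elim i 0, Subsingleton.elim j 0]
        simpa [Matrix.trace] using hξ
    rw [this, map_zero, smul_zero]
  obtain ⟨c, hc⟩ := exists_eq_smul_of_conj_equivariant
    (averageConj (gaussianMatrix N) CFC.abs) fun V hV ξ => averageConj_cfcAbs_equivariant hV ξ
  refine ⟨c, ?_, hc⟩
  set T := averageConj (gaussianMatrix N) CFC.abs with hT
  have hN0 : (N : ℂ) ≠ 0 := by
    have : N ≠ 0 := by omega
    exact_mod_cast this
  -- The left side is the trace of `T` as an operator on `M_N`, which equals `𝔼 |tr |Y||²`. It is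
  -- compared with `c (N² - 1)` from trace-zero matrices plus `1` from the identity direction, `tr
  -- T(1)` being `N`.
  have h1 : ∑ k, ∑ l, T (Matrix.single k l 1) k l =
      ((∫ A : Matrix (Fin N) (Fin N) ℂ, ‖(CFC.abs A).trace‖ ^ 2 ∂gaussianMatrix N : ℝ) : ℂ) := by
    rw [← integral_complex_ofReal]
    simp_rw [← sum_mul_star_diag_eq]
    rw [integral_finsetSum _ fun k _ => integrable_finsetSum _ fun l _ =>
      integrable_mul_cfcAbs_entry k k l l]
    refine Finset.sum_congr rfl fun k _ => ?_
    rw [integral_finsetSum _ fun l _ => integrable_mul_cfcAbs_entry k k l l]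
    refine Finset.sum_congr rfl fun l _ => ?_
    rw [hT, averageConj_apply integrable_mul_cfcAbs_entry]
    simp_rw [mul_mul_conjTranspose_apply, Matrix.single_apply]
    congr 1
    ext A
    rw [Finset.sum_eq_single k (by
      intro b _ hb
      exact Finset.sum_eq_zero fun x _ => by rw [if_neg (fun h => hb h.1.symm), zero_mul])
      (by simp), Finset.sum_eq_single l (by
      intro b _ hb
      rw [if_neg (fun h => hb h.2.symm), zero_mul]) (by simp)]
    simp
  have h2 : ∑ k, T 1 k k = N := by
    have : ∀ k, T 1 k k = ∫ A : Matrix (Fin N) (Fin N) ℂ,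
        (CFC.abs A * 1 * (CFC.abs A)ᴴ : Matrix (Fin N) (Fin N) ℂ) k k ∂gaussianMatrix N := fun k =>
      averageConj_apply integrable_mul_cfcAbs_entry 1 k k
    simp_rw [this]
    rw [← integral_finsetSum _ fun k _ =>
      integrable_mul_mul_conjTranspose integrable_mul_cfcAbs_entry 1 k k]
    have h3 : ∀ A : Matrix (Fin N) (Fin N) ℂ,
        ∑ k, (CFC.abs A * 1 * (CFC.abs A)ᴴ : Matrix (Fin N) (Fin N) ℂ) k k =
        ((∑ i, ∑ j, ‖A i j‖ ^ 2 : ℝ) : ℂ) := by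
      intro A
      rw [← sum_norm_sq_cfcAbs, sum_norm_sq_eq_trace, conjTranspose_cfcAbs, Matrix.mul_one]
      rfl
    simp_rw [h3]
    rw [integral_complex_ofReal, integral_sum_norm_sq]
    simp
  have h3 : ∀ k l, T (Matrix.single k l 1) k l =
      c + if k = l then (T 1 k k - c) / N else 0 := by
    intro k l
    have htr : (Matrix.single k l 1 - (if k = l then (1 / N : ℂ) else 0) • 1 :
        Matrix (Fin N) (Fin N) ℂ).trace = 0 := by
      rw [Matrix.trace_sub, Matrix.trace_smul, Matrix.trace_one]
      split_ifs with h
      · subst h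
        simp [hN0]
      · simp [Matrix.trace_single_eq_of_ne _ _ _ h]
    have h4 := congrFun (congrFun (hc _ htr) k) l
    rw [map_sub, map_smul] at h4
    simp only [Matrix.sub_apply, Matrix.smul_apply, Matrix.single_apply_same, smul_eq_mul,
      Matrix.one_apply] at h4
    split_ifs at h4 ⊢ with h
    · subst h
      linear_combination h4
    · simp at h4
      linear_combination h4
  have h4 : c * ((N : ℂ) ^ 2 - 1) + 1 =
      ((∫ A : Matrix (Fin N) (Fin N) ℂ, ‖(CFC.abs A).trace‖ ^ 2 ∂gaussianMatrix N : ℝ) : ℂ) := by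
    rw [← h1]
    simp_rw [h3]
    simp only [Finset.sum_add_distrib, Finset.sum_ite_eq, Finset.mem_univ, if_true,
      ← Finset.sum_div, Finset.sum_sub_distrib, h2, Finset.sum_const, Finset.card_univ,
      Fintype.card_fin, nsmul_eq_mul]
    field_simp
    ring
  set Q := ∫ A : Matrix (Fin N) (Fin N) ℂ, ‖(CFC.abs A).trace‖ ^ 2 ∂gaussianMatrix N
  have hQ1 : (N : ℝ) ≤ Q := le_integral_norm_sq_trace_cfcAbs
  have hQ2 : 9 / 64 * (N : ℝ) ^ 2 ≤ Q := sq_le_integral_norm_sq_trace_cfcAbs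
  have hN2 : (2 : ℝ) ≤ N := by exact_mod_cast hN
  have h5 : c * (((N : ℝ) ^ 2 - 1 : ℝ) : ℂ) = ((Q - 1 : ℝ) : ℂ) := by
    push_cast
    linear_combination h4
  have h6 := congrArg norm h5
  rw [norm_mul, Complex.norm_of_nonneg (by nlinarith), Complex.norm_of_nonneg (by linarith)] at h6
  -- This fixes the constant 12. The bound `Q ≥ N` suffices for `2 ≤ N ≤ 3`, and `Q ≥ (9/64) N²`
  -- suffices from `N = 4` on, with equality in the required estimate at `N = 4`.
  have h7 : ((N : ℝ) ^ 2 - 1) / 12 ≤ Q - 1 := by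
    rcases Nat.lt_or_ge N 4 with h | h
    · have : (N : ℝ) ≤ 3 := by
        have : N ≤ 3 := by omega
        exact_mod_cast this
      nlinarith
    · have : (4 : ℝ) ≤ N := by exact_mod_cast h
      nlinarith
  rw [← h6] at h7
  have h8 : 0 < (N : ℝ) ^ 2 - 1 := by nlinarith
  by_contra hcon
  push Not at hcon
  nlinarith

end Constant

/-! ### The projection onto the identity, and averages of tensors times `I - P` -/

section Projection

variable {N : ℕ}

theorem isStarProjection_projId (N : ℕ) : IsStarProjection (projId N) := by
  have h := isStarProjection_starProjection
    (U := Submodule.span ℂ {hsVec (1 : Matrix (Fin N) (Fin N) ℂ)})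
  refine ⟨?_, ?_⟩
  · apply EquivLike.injective (Matrix.toEuclideanCLM (n := Fin N × Fin N) (𝕜 := ℂ))
    rw [map_mul, projId, StarAlgEquiv.apply_symm_apply, h.isIdempotentElem]
  · apply EquivLike.injective (Matrix.toEuclideanCLM (n := Fin N × Fin N) (𝕜 := ℂ))
    rw [map_star, projId, StarAlgEquiv.apply_symm_apply, h.isSelfAdjoint]

/-- A column of `I - P` is orthogonal to the identity matrix for the Hilbert-Schmidt inner product.
Together with `tensorBar_mul_apply` this reduces averages of tensors times `I - P` to `averageConj`
on matrices of trace zero. -/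
theorem trace_one_sub_projId_column (q : Fin N × Fin N) :
    (Matrix.of fun k l => (1 - projId N) (k, l) q : Matrix (Fin N) (Fin N) ℂ).trace = 0 := by
  set K := Submodule.span ℂ {hsVec (1 : Matrix (Fin N) (Fin N) ℂ)} with hK
  set e : EuclideanSpace ℂ (Fin N × Fin N) := EuclideanSpace.single q 1 with he
  have h1 : e - K.starProjection e ∈ Kᗮ := Submodule.sub_starProjection_mem_orthogonal e
  have h2 := Submodule.inner_right_of_mem_orthogonal
    (Submodule.mem_span_singleton_self (hsVec (1 : Matrix (Fin N) (Fin N) ℂ))) h1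
  have h3 : K.starProjection = Matrix.toEuclideanCLM (n := Fin N × Fin N) (𝕜 := ℂ) (projId N) := by
    rw [projId, StarAlgEquiv.apply_symm_apply]
  have h4 : e - K.starProjection e =
      Matrix.toEuclideanCLM (n := Fin N × Fin N) (𝕜 := ℂ) (1 - projId N) e := by
    rw [h3, map_sub, map_one]
    rfl
  have h5 : ∀ p, (e - K.starProjection e) p = (1 - projId N) p q := by
    intro p
    rw [h4, he]
    simp [Matrix.ofLp_toEuclideanCLM, Matrix.one_apply]
  rw [PiLp.inner_apply, Fintype.sum_prod_type] at h2
  simp only [h5, hsVec, Matrix.one_apply, RCLike.inner_apply] at h2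
  simpa [Matrix.trace] using h2

theorem tensorBar_mul_apply (x y : Matrix (Fin N) (Fin N) ℂ)
    (M : Matrix (Fin N × Fin N) (Fin N × Fin N) ℂ) (p q : Fin N × Fin N) :
    (tensorBar x y * M) p q = (x * (Matrix.of fun k l => M (k, l) q) * yᴴ) p.1 p.2 := by
  simp only [tensorBar, Matrix.mul_apply, Matrix.kroneckerMap_apply, Matrix.map_apply,
    Matrix.conjTranspose_apply, Fintype.sum_prod_type, Finset.sum_mul, Matrix.of_apply]
  rw [Finset.sum_comm]
  refine Finset.sum_congr rfl fun k _ => Finset.sum_congr rfl fun l _ => ?_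
  simp only [starRingEnd_apply]
  ring

theorem integrable_tensorBar_mul (M : Matrix (Fin N × Fin N) (Fin N × Fin N) ℂ)
    (p q : Fin N × Fin N) :
    Integrable (fun A => (tensorBar A A * M) p q) (gaussianMatrix N) := by
  simp_rw [tensorBar_mul_apply]
  exact integrable_mul_mul_conjTranspose integrable_mul_entry _ _ _

theorem integral_tensorBar_mul_one_sub_projId (p q : Fin N × Fin N) :
    ∫ A, (tensorBar A A * (1 - projId N)) p q ∂gaussianMatrix N = 0 := by
  simp_rw [tensorBar_mul_apply]
  rw [← averageConj_apply integrable_mul_entry,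
    averageConj_gaussian_eq_zero (trace_one_sub_projId_column q)]
  rfl

open scoped MatrixOrder ComplexOrder

theorem integrable_tensorBar_cfcAbs_mul (M : Matrix (Fin N × Fin N) (Fin N × Fin N) ℂ)
    (p q : Fin N × Fin N) :
    Integrable (fun A : Matrix (Fin N) (Fin N) ℂ => (tensorBar (CFC.abs A) (CFC.abs A) * M) p q)
      (gaussianMatrix N) := by
  simp_rw [tensorBar_mul_apply]
  exact integrable_mul_mul_conjTranspose integrable_mul_cfcAbs_entry _ _ _

theorem exists_integral_tensorBar_cfcAbs (N : ℕ) :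
    ∃ c : ℂ, 1 / 12 ≤ ‖c‖ ∧ ∀ p q, ∫ A : Matrix (Fin N) (Fin N) ℂ,
      (tensorBar (CFC.abs A) (CFC.abs A) * (1 - projId N)) p q ∂gaussianMatrix N =
        c * (1 - projId N) p q := by
  obtain ⟨c, hc, h⟩ := exists_averageConj_cfcAbs_eq_smul N
  refine ⟨c, hc, fun p q => ?_⟩
  simp_rw [tensorBar_mul_apply]
  rw [← averageConj_apply integrable_mul_cfcAbs_entry, h _ (trace_one_sub_projId_column q)]
  rfl

end Projection

/-! ### Jensen's inequality for powers of seminorms -/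

section Jensen

theorem continuous_seminorm_pi {κ : Type*} [Fintype κ] (Ψ : Seminorm ℂ (κ → ℂ)) :
    Continuous Ψ := by
  have h : ConvexOn ℝ Set.univ Ψ := by
    refine ⟨convex_univ, fun x _ y _ a b ha hb _ => ?_⟩
    have h1 : ∀ r : ℝ, 0 ≤ r → ∀ z, Ψ (r • z) = r * Ψ z := fun r hr z => by
      have : r • z = (r : ℂ) • z := by ext; simp
      rw [this, map_smul_eq_mul, Complex.norm_of_nonneg hr]
    rw [smul_eq_mul, smul_eq_mul, ← h1 a ha, ← h1 b hb]
    exact map_add_le_add Ψ _ _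
  exact continuousOn_univ.1 (h.continuousOn isOpen_univ)

theorem convexOn_seminorm_rpow {κ : Type*} (Ψ : Seminorm ℂ (κ → ℂ)) {p : ℝ}
    (hp : 1 ≤ p) : ConvexOn ℝ Set.univ fun x => Ψ x ^ p := by
  refine ⟨convex_univ, fun x _ y _ a b ha hb hab => ?_⟩
  have h1 : ∀ r : ℝ, 0 ≤ r → ∀ z, Ψ (r • z) = r * Ψ z := fun r hr z => by
    have : r • z = (r : ℂ) • z := by ext; simp
    rw [this, map_smul_eq_mul, Complex.norm_of_nonneg hr]
  have h2 := map_add_le_add Ψ (a • x) (b • y)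
  rw [h1 a ha, h1 b hb] at h2
  refine (Real.rpow_le_rpow (apply_nonneg _ _) h2 (by linarith)).trans ?_
  exact (convexOn_rpow hp).2 (apply_nonneg Ψ x) (apply_nonneg Ψ y) ha hb hab

/-- If the right side is infinite there is nothing to prove; otherwise `Ψ (f ·) ^ p` is integrable
and Jensen applies to the continuous convex function `Ψ ^ p`. -/
theorem seminorm_rpow_integral_le {κ α : Type*} [Fintype κ] [MeasurableSpace α] {μ : Measure α}
    [IsProbabilityMeasure μ] (Ψ : Seminorm ℂ (κ → ℂ)) {p : ℝ} (hp : 1 ≤ p) (f : α → κ → ℂ)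
    (hf : ∀ k, Integrable (fun x => f x k) μ) :
    ENNReal.ofReal (Ψ (fun k => ∫ x, f x k ∂μ) ^ p) ≤ ∫⁻ x, ENNReal.ofReal (Ψ (f x) ^ p) ∂μ := by
  by_cases hfin : ∫⁻ x, ENNReal.ofReal (Ψ (f x) ^ p) ∂μ = ∞
  · rw [hfin]; exact le_top
  have hint : Integrable f μ := Integrable.of_eval hf
  have hcont : Continuous fun x => Ψ x ^ p :=
    (continuous_seminorm_pi Ψ).rpow_const fun _ => Or.inr (by linarith)
  have hnn : 0 ≤ᵐ[μ] fun x => Ψ (f x) ^ p :=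
    Filter.Eventually.of_forall fun x => Real.rpow_nonneg (apply_nonneg _ _) _
  have hm : AEStronglyMeasurable (fun x => Ψ (f x) ^ p) μ :=
    hcont.comp_aestronglyMeasurable hint.aestronglyMeasurable
  have hint2 : Integrable (fun x => Ψ (f x) ^ p) μ :=
    (lintegral_ofReal_ne_top_iff_integrable hm hnn).1 hfin
  have h := (convexOn_seminorm_rpow Ψ hp).map_integral_le hcont.continuousOn isClosed_univ
    (Filter.Eventually.of_forall fun _ => Set.mem_univ _) hint hint2
  have h2 : (∫ x, f x ∂μ) = fun k => ∫ x, f x k ∂μ := funext fun k => eval_integral hf k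
  rw [h2] at h
  rw [← ofReal_integral_eq_lintegral_ofReal hint2 hnn]
  exact ENNReal.ofReal_le_ofReal h

variable {n : ℕ} {I : Type*}

/-- Tuples of matrices as functions of their coordinates. -/
def coordsToTuple (n : ℕ) (I : Type*) :
    (Fin n × I × I → ℂ) →ₗ[ℂ] (Fin n → Matrix I I ℂ) where
  toFun v j := Matrix.of fun a b => v (j, a, b)
  map_add' _ _ := rfl
  map_smul' _ _ := rfl

theorem measurable_seminorm_tuple [Fintype I] {α : Type*} [MeasurableSpace α]
    (Ψ : Seminorm ℂ (Fin n → Matrix I I ℂ)) (p : ℝ) {F : α → Fin n → Matrix I I ℂ}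
    (hF : ∀ j, Measurable fun x => F x j) :
    Measurable fun x => ENNReal.ofReal (Ψ (F x) ^ p) := by
  have h1 : Measurable fun x => fun k : Fin n × I × I => F x k.1 k.2.1 k.2.2 :=
    measurable_pi_lambda _ fun k => measurable_matrix_iff.1 (hF k.1) _ _
  have h2 := (continuous_seminorm_pi (Ψ.comp (coordsToTuple n I))).measurable.comp h1
  exact (Measurable.pow_const h2 p).ennreal_ofReal

theorem seminorm_rpow_integral_tuple_le [Fintype I] {α : Type*} [MeasurableSpace α]
    {μ : Measure α} [IsProbabilityMeasure μ] (Ψ : Seminorm ℂ (Fin n → Matrix I I ℂ)) {p : ℝ}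
    (hp : 1 ≤ p) (F : α → Fin n → Matrix I I ℂ)
    (hF : ∀ j a b, Integrable (fun x => F x j a b) μ) (X : Fin n → Matrix I I ℂ)
    (hX : ∀ j a b, ∫ x, F x j a b ∂μ = X j a b) :
    ENNReal.ofReal (Ψ X ^ p) ≤ ∫⁻ x, ENNReal.ofReal (Ψ (F x) ^ p) ∂μ := by
  have h := seminorm_rpow_integral_le (μ := μ) (Ψ.comp (coordsToTuple n I)) hp
    (fun x (k : Fin n × I × I) => F x k.1 k.2.1 k.2.2) (fun k => hF _ _ _)
  have h1 : coordsToTuple n I (fun k => ∫ x, F x k.1 k.2.1 k.2.2 ∂μ) = X := by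
    ext j a b
    exact hX j a b
  rw [Seminorm.comp_apply, h1] at h
  exact h

end Jensen

/-! ### Measurability of products, differences and tensors -/

section Measurability

variable {α : Type*} [MeasurableSpace α] {N : ℕ}

theorem _root_.Measurable.matrix_mul {l m n : Type*} [Fintype m] {f : α → Matrix l m ℂ}
    {g : α → Matrix m n ℂ} (hf : Measurable f) (hg : Measurable g) :
    Measurable fun x => f x * g x := by
  rw [measurable_matrix_iff] at hf hg ⊢
  intro i j
  simp only [Matrix.mul_apply]
  exact Finset.measurable_sum _ fun k _ => (hf i k).mul (hg k j)

theorem _root_.Measurable.tensorBar {f g : α → Matrix (Fin N) (Fin N) ℂ} (hf : Measurable f)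
    (hg : Measurable g) : Measurable fun x => tensorBar (f x) (g x) := by
  rw [measurable_matrix_iff] at hf hg ⊢
  intro i j
  exact (hf i.1 j.1).mul (Complex.continuous_conj.measurable.comp (hg i.2 j.2))

theorem _root_.Measurable.matrix_sub {m n : Type*} {f g : α → Matrix m n ℂ} (hf : Measurable f)
    (hg : Measurable g) : Measurable fun x => f x - g x :=
  measurable_matrix_sub.comp (hf.prodMk hg)

end Measurability

/-! ### Algebra of the tensors -/

section TensorBar

variable {N : ℕ}

theorem tensorBar_mul_tensorBar (x y z w : Matrix (Fin N) (Fin N) ℂ) :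
    tensorBar x y * tensorBar z w = tensorBar (x * z) (y * w) := by
  rw [tensorBar, tensorBar, tensorBar, ← Matrix.mul_kronecker_mul, ← Matrix.map_mul]

/-- Polarization: the diagonal terms cancel and each mixed term appears twice with weight `1/2`.
Decoupling rests on this identity. -/
theorem tensorBar_rotatePair (x : Matrix (Fin N) (Fin N) ℂ × Matrix (Fin N) (Fin N) ℂ) :
    tensorBar (rotatePair x).1 (rotatePair x).1 - tensorBar (rotatePair x).2 (rotatePair x).2 =
      tensorBar x.1 x.2 + tensorBar x.2 x.1 := by
  ext i j
  simp only [tensorBar, rotatePair, Matrix.sub_apply, Matrix.add_apply, Matrix.kroneckerMap_apply,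
    Matrix.map_apply, Matrix.smul_apply, smul_eq_mul, map_mul, conj_invSqrtTwo, map_add, map_sub]
  linear_combination (2 * (x.1 i.1 j.1 * (starRingEnd ℂ) (x.2 i.2 j.2) +
    x.2 i.1 j.1 * (starRingEnd ℂ) (x.1 i.2 j.2))) * invSqrtTwo_mul_self

end TensorBar

/-! ### Translation invariance of the Haar and Gaussian tuples -/

section Haar

variable {N : ℕ}

instance : IsProbabilityMeasure (haarUnitary N) :=
  ⟨by simpa [haarUnitary] using
    Measure.haarMeasure_self (K₀ := (⊤ : TopologicalSpace.PositiveCompacts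
      (Matrix.unitaryGroup (Fin N) ℂ)))⟩

instance : (haarUnitary N).IsHaarMeasure := by
  unfold haarUnitary
  infer_instance

/-- A right translate of Haar measure is again left invariant, hence a multiple of it, and the total
mass shows that the factor is `1`. -/
instance : (haarUnitary N).IsMulRightInvariant := by
  refine ⟨fun g => ?_⟩
  have hm : Measurable fun x : Matrix.unitaryGroup (Fin N) ℂ => x * g :=
    Continuous.measurable (by fun_prop)
  have hp : IsProbabilityMeasure ((haarUnitary N).map fun x => x * g) :=
    Measure.isProbabilityMeasure_map hm.aemeasurable
  have h := Measure.isMulInvariant_eq_smul_of_compactSpace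
    ((haarUnitary N).map fun x => x * g) (haarUnitary N)
  have h1 := congrArg (fun μ => μ Set.univ) h
  simp only [measure_univ, Measure.smul_apply] at h1
  rw [h]
  set c := ((haarUnitary N).map fun x => x * g).haarScalarFactor (haarUnitary N)
  have hc : c = 1 := by
    rw [ENNReal.smul_def, smul_eq_mul, mul_one] at h1
    exact_mod_cast h1.symm
  rw [hc, one_smul]

theorem measurePreserving_pi_mul_right {n : ℕ} (g : Fin n → Matrix.unitaryGroup (Fin N) ℂ) :
    MeasurePreserving (fun u : Fin n → Matrix.unitaryGroup (Fin N) ℂ => fun j => u j * g j)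
      (Measure.pi fun _ => haarUnitary N) (Measure.pi fun _ => haarUnitary N) :=
  measurePreserving_pi _ _ fun j =>
    ⟨Continuous.measurable (by fun_prop), map_mul_right_eq_self (haarUnitary N) (g j)⟩

theorem measurePreserving_pi_unitary_mul {n : ℕ} (u : Fin n → Matrix.unitaryGroup (Fin N) ℂ) :
    MeasurePreserving (fun y : Fin n → Matrix (Fin N) (Fin N) ℂ => fun j =>
      (u j : Matrix (Fin N) (Fin N) ℂ) * y j)
      (Measure.pi fun _ => gaussianMatrix N) (Measure.pi fun _ => gaussianMatrix N) :=
  measurePreserving_pi _ _ fun j =>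
    ⟨Continuous.measurable (by fun_prop), gaussianMatrix_map_mul_left (u j).2⟩

end Haar

/-! ### From Haar unitaries to decoupled Gaussians, for a general seminorm -/

section Comparison

open scoped MatrixOrder ComplexOrder

variable {N n : ℕ} (Ψ : Seminorm ℂ (Fin n → Matrix (Fin N × Fin N) (Fin N × Fin N) ℂ)) {p : ℝ}

/-- The law of `n` independent complex Gaussian matrices. -/
noncomputable abbrev gaussianTuple (N n : ℕ) : Measure (Fin n → Matrix (Fin N) (Fin N) ℂ) :=
  Measure.pi fun _ => gaussianMatrix N

/-- The law of `n` independent Haar unitary matrices. -/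
noncomputable abbrev haarTuple (N n : ℕ) : Measure (Fin n → Matrix.unitaryGroup (Fin N) ℂ) :=
  Measure.pi fun _ => haarUnitary N

theorem integrable_eval_gaussianTuple {f : Matrix (Fin N) (Fin N) ℂ → ℂ}
    (hf : Integrable f (gaussianMatrix N)) (j : Fin n) :
    Integrable (fun y => f (y j)) (gaussianTuple N n) :=
  (measurePreserving_eval (fun _ : Fin n => gaussianMatrix N) j).integrable_comp_of_integrable hf

theorem integral_eval_gaussianTuple {f : Matrix (Fin N) (Fin N) ℂ → ℂ}
    (hf : Integrable f (gaussianMatrix N)) (j : Fin n) :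
    ∫ y, f (y j) ∂gaussianTuple N n = ∫ A, f A ∂gaussianMatrix N := by
  have h := measurePreserving_eval (fun _ : Fin n => gaussianMatrix N) j
  conv_rhs => rw [← h.map_eq]
  rw [integral_map h.measurable.aemeasurable (by rw [h.map_eq]; exact hf.aestronglyMeasurable)]

/-- The tuple `U_j |Y_j| ⊗ conj (U_j |Y_j|) (I - P)` averages to a multiple of
`U_j ⊗ conj U_j (I - P)`. -/
theorem exists_lintegral_unitary_le_cfcAbs (hp : 1 ≤ p) (N : ℕ) :
    ∃ c : ℂ, 1 / 12 ≤ ‖c‖ ∧ ∀ (n : ℕ)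
      (Ψ : Seminorm ℂ (Fin n → Matrix (Fin N × Fin N) (Fin N × Fin N) ℂ))
      (u : Fin n → Matrix.unitaryGroup (Fin N) ℂ),
      ENNReal.ofReal (Ψ (fun j => c • (tensorBar (u j : Matrix (Fin N) (Fin N) ℂ) (u j) *
        (1 - projId N))) ^ p) ≤
      ∫⁻ y, ENNReal.ofReal (Ψ (fun j =>
        tensorBar ((u j : Matrix (Fin N) (Fin N) ℂ) * CFC.abs (y j))
          ((u j : Matrix (Fin N) (Fin N) ℂ) * CFC.abs (y j)) * (1 - projId N)) ^ p)
          ∂gaussianTuple N n := by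
  obtain ⟨c, hc, h⟩ := exists_integral_tensorBar_cfcAbs N
  refine ⟨c, hc, fun n Ψ u => ?_⟩
  have hI : ∀ (j : Fin n) (a b r), Integrable (fun y : Fin n → Matrix (Fin N) (Fin N) ℂ =>
      tensorBar (u j : Matrix (Fin N) (Fin N) ℂ) (u j) a r *
        (tensorBar (CFC.abs (y j)) (CFC.abs (y j)) * (1 - projId N)) r b)
        (gaussianTuple N n) := fun j a b r =>
    (integrable_eval_gaussianTuple (integrable_tensorBar_cfcAbs_mul _ r b) j).const_mul _
  -- The unitary factor splits off on the left, so for fixed `u` only the tensor of `|Y_j|` is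
  -- averaged.
  have hexp : ∀ (j : Fin n) (a b) (y : Fin n → Matrix (Fin N) (Fin N) ℂ),
      (tensorBar ((u j : Matrix (Fin N) (Fin N) ℂ) * CFC.abs (y j))
          ((u j : Matrix (Fin N) (Fin N) ℂ) * CFC.abs (y j)) * (1 - projId N)) a b =
      ∑ r, tensorBar (u j : Matrix (Fin N) (Fin N) ℂ) (u j) a r *
        (tensorBar (CFC.abs (y j)) (CFC.abs (y j)) * (1 - projId N)) r b := by
    intro j a b y
    rw [← tensorBar_mul_tensorBar, Matrix.mul_assoc, Matrix.mul_apply]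
  refine seminorm_rpow_integral_tuple_le Ψ hp _ (fun j a b => ?_) _ (fun j a b => ?_)
  · simp_rw [hexp]
    exact integrable_finsetSum _ fun r _ => hI j a b r
  · simp_rw [hexp]
    rw [integral_finsetSum _ fun r _ => hI j a b r, Matrix.smul_apply, Matrix.mul_apply,
      smul_eq_mul, Finset.mul_sum]
    refine Finset.sum_congr rfl fun r _ => ?_
    rw [integral_const_mul, integral_eval_gaussianTuple (integrable_tensorBar_cfcAbs_mul _ r b), h]
    ring

/-- Replacing `|Y|` by `Y` and removing the Haar unitaries. -/
theorem lintegral_cfcAbs_eq_gaussian :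
    ∫⁻ u, ∫⁻ y, ENNReal.ofReal (Ψ (fun j =>
        tensorBar ((u j : Matrix (Fin N) (Fin N) ℂ) * CFC.abs (y j))
          ((u j : Matrix (Fin N) (Fin N) ℂ) * CFC.abs (y j)) * (1 - projId N)) ^ p)
          ∂gaussianTuple N n ∂haarTuple N n =
      ∫⁻ y, ENNReal.ofReal (Ψ (fun j => tensorBar (y j) (y j) * (1 - projId N)) ^ p)
        ∂gaussianTuple N n := by
  have hu : ∀ j : Fin n, Measurable fun x : (Fin n → Matrix.unitaryGroup (Fin N) ℂ) ×
      (Fin n → Matrix (Fin N) (Fin N) ℂ) => (x.1 j : Matrix (Fin N) (Fin N) ℂ) := fun j =>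
    measurable_subtype_coe.comp ((measurable_pi_apply j).comp measurable_fst)
  have hy : ∀ j : Fin n, Measurable fun x : (Fin n → Matrix.unitaryGroup (Fin N) ℂ) ×
      (Fin n → Matrix (Fin N) (Fin N) ℂ) => x.2 j := fun j =>
    (measurable_pi_apply j).comp measurable_snd
  have hmeas : ∀ g : (Fin n → Matrix.unitaryGroup (Fin N) ℂ) ×
      (Fin n → Matrix (Fin N) (Fin N) ℂ) → Fin n → Matrix (Fin N) (Fin N) ℂ,
      (∀ j, Measurable fun x => g x j) → Measurable fun x => ENNReal.ofReal (Ψ (fun j =>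
        tensorBar (g x j) (g x j) * (1 - projId N)) ^ p) := fun g hg =>
    measurable_seminorm_tuple Ψ p fun j =>
      ((hg j).tensorBar (hg j)).matrix_mul measurable_const
  have hm1 := hmeas (fun x j => (x.1 j : Matrix (Fin N) (Fin N) ℂ) * CFC.abs (x.2 j))
    fun j => (hu j).matrix_mul (measurable_cfcAbs.comp (hy j))
  have hm2 := hmeas (fun x j => (x.1 j : Matrix (Fin N) (Fin N) ℂ) * x.2 j)
    fun j => (hu j).matrix_mul (hy j)
  rw [lintegral_lintegral_swap hm1.aemeasurable]
  have h1 : ∀ y : Fin n → Matrix (Fin N) (Fin N) ℂ, ∫⁻ u, ENNReal.ofReal (Ψ (fun j =>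
        tensorBar ((u j : Matrix (Fin N) (Fin N) ℂ) * CFC.abs (y j))
          ((u j : Matrix (Fin N) (Fin N) ℂ) * CFC.abs (y j)) * (1 - projId N)) ^ p)
          ∂haarTuple N n =
      ∫⁻ u, ENNReal.ofReal (Ψ (fun j => tensorBar ((u j : Matrix (Fin N) (Fin N) ℂ) * y j)
          ((u j : Matrix (Fin N) (Fin N) ℂ) * y j) * (1 - projId N)) ^ p) ∂haarTuple N n := by
    intro y
    -- With `y` frozen, the polar factor `w j` is absorbed by right translation of `u j`. The choice
    -- is made separately for each `y`, so measurability of `w` in `y` is not needed.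
    choose w hw hwy using fun j => exists_polar (y j)
    have hmp := measurePreserving_pi_mul_right (fun j => (⟨w j, hw j⟩ :
      Matrix.unitaryGroup (Fin N) ℂ))
    have hm3 : Measurable fun u : Fin n → Matrix.unitaryGroup (Fin N) ℂ =>
        ENNReal.ofReal (Ψ (fun j =>
        tensorBar ((u j : Matrix (Fin N) (Fin N) ℂ) * CFC.abs (y j))
          ((u j : Matrix (Fin N) (Fin N) ℂ) * CFC.abs (y j)) * (1 - projId N)) ^ p) :=
      measurable_seminorm_tuple Ψ p fun j =>
        have h : Measurable fun u : Fin n → Matrix.unitaryGroup (Fin N) ℂ =>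
            (u j : Matrix (Fin N) (Fin N) ℂ) * CFC.abs (y j) :=
          (measurable_subtype_coe.comp (measurable_pi_apply j)).matrix_mul measurable_const
        (h.tensorBar h).matrix_mul measurable_const
    rw [← hmp.lintegral_comp hm3]
    refine lintegral_congr fun u => ?_
    have : ∀ j, ((u j * ⟨w j, hw j⟩ : Matrix.unitaryGroup (Fin N) ℂ) :
        Matrix (Fin N) (Fin N) ℂ) * CFC.abs (y j) = u j * y j := by
      intro j
      conv_rhs => rw [hwy j]
      rw [← Matrix.mul_assoc]
      rfl
    simp only [this]
  simp_rw [h1]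
  rw [← lintegral_lintegral_swap hm2.aemeasurable]
  have h2 : ∀ u : Fin n → Matrix.unitaryGroup (Fin N) ℂ, ∫⁻ y, ENNReal.ofReal (Ψ (fun j =>
        tensorBar ((u j : Matrix (Fin N) (Fin N) ℂ) * y j)
          ((u j : Matrix (Fin N) (Fin N) ℂ) * y j) * (1 - projId N)) ^ p) ∂gaussianTuple N n =
      ∫⁻ y, ENNReal.ofReal (Ψ (fun j => tensorBar (y j) (y j) * (1 - projId N)) ^ p)
        ∂gaussianTuple N n := by
    intro u
    have hm3 : Measurable fun y : Fin n → Matrix (Fin N) (Fin N) ℂ =>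
        ENNReal.ofReal (Ψ (fun j => tensorBar (y j) (y j) * (1 - projId N)) ^ p) :=
      measurable_seminorm_tuple Ψ p fun j =>
        ((measurable_pi_apply j).tensorBar (measurable_pi_apply j)).matrix_mul measurable_const
    exact (measurePreserving_pi_unitary_mul u).lintegral_comp hm3
  simp_rw [h2]
  simp

/-- Symmetrization. -/
theorem lintegral_gaussian_le_symmetrized (hp : 1 ≤ p) :
    ∫⁻ y, ENNReal.ofReal (Ψ (fun j => tensorBar (y j) (y j) * (1 - projId N)) ^ p)
        ∂gaussianTuple N n ≤
      ∫⁻ x, ENNReal.ofReal (Ψ (fun j => (tensorBar (x.1 j) (x.1 j) - tensorBar (x.2 j) (x.2 j)) *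
        (1 - projId N)) ^ p) ∂(gaussianTuple N n).prod (gaussianTuple N n) := by
  have h1 : ∀ j : Fin n, Measurable fun x : (Fin n → Matrix (Fin N) (Fin N) ℂ) ×
      (Fin n → Matrix (Fin N) (Fin N) ℂ) => x.1 j := fun j =>
    (measurable_pi_apply j).comp measurable_fst
  have h2 : ∀ j : Fin n, Measurable fun x : (Fin n → Matrix (Fin N) (Fin N) ℂ) ×
      (Fin n → Matrix (Fin N) (Fin N) ℂ) => x.2 j := fun j =>
    (measurable_pi_apply j).comp measurable_snd
  have hm : Measurable fun x : (Fin n → Matrix (Fin N) (Fin N) ℂ) ×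
      (Fin n → Matrix (Fin N) (Fin N) ℂ) => ENNReal.ofReal (Ψ (fun j =>
        (tensorBar (x.1 j) (x.1 j) - tensorBar (x.2 j) (x.2 j)) * (1 - projId N)) ^ p) :=
    measurable_seminorm_tuple Ψ p fun j => (((h1 j).tensorBar (h1 j)).matrix_sub
      ((h2 j).tensorBar (h2 j))).matrix_mul measurable_const
  rw [lintegral_prod _ hm.aemeasurable]
  -- For fixed `y`, the second copy has mean zero after multiplication by `I - P`, so the integrand
  -- on the left is `Ψ ^ p` of the mean over that copy.
  refine lintegral_mono fun y => ?_
  refine seminorm_rpow_integral_tuple_le Ψ hp _ (fun j a b => ?_) _ (fun j a b => ?_)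
  · simp_rw [sub_mul, Matrix.sub_apply]
    exact (integrable_const _).sub
      (integrable_eval_gaussianTuple (integrable_tensorBar_mul _ a b) j)
  · simp_rw [sub_mul, Matrix.sub_apply]
    rw [integral_sub (integrable_const _)
      (integrable_eval_gaussianTuple (integrable_tensorBar_mul _ a b) j),
      integral_eval_gaussianTuple (integrable_tensorBar_mul _ a b),
      integral_tensorBar_mul_one_sub_projId]
    simp

theorem ofReal_rpow_seminorm_add_le (hp : 1 ≤ p)
    (X Z : Fin n → Matrix (Fin N × Fin N) (Fin N × Fin N) ℂ) :
    ENNReal.ofReal (Ψ (fun j => X j + Z j) ^ p) ≤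
      2 ^ (p - 1) * (ENNReal.ofReal (Ψ X ^ p) + ENNReal.ofReal (Ψ Z ^ p)) := by
  have hp0 : 0 ≤ p := by linarith
  simp only [← ENNReal.ofReal_rpow_of_nonneg (apply_nonneg Ψ _) hp0]
  refine le_trans ?_ (ENNReal.rpow_add_le_mul_rpow_add_rpow _ _ hp)
  rw [← ENNReal.ofReal_add (apply_nonneg Ψ _) (apply_nonneg Ψ _)]
  exact ENNReal.rpow_le_rpow (ENNReal.ofReal_le_ofReal (map_add_le_add Ψ X Z)) hp0

/-- Decoupling, by invariance of the Gaussian law under rotations. -/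
theorem lintegral_symmetrized_le_decoupled (hp : 1 ≤ p)
    (hΨ : ∀ X, Ψ (fun j => X j * (1 - projId N)) ≤ Ψ X) :
    ∫⁻ x, ENNReal.ofReal (Ψ (fun j => (tensorBar (x.1 j) (x.1 j) - tensorBar (x.2 j) (x.2 j)) *
        (1 - projId N)) ^ p) ∂(gaussianTuple N n).prod (gaussianTuple N n) ≤
      2 ^ p * ∫⁻ x, ENNReal.ofReal (Ψ (fun j => tensorBar (x.1 j) (x.2 j)) ^ p)
        ∂(gaussianTuple N n).prod (gaussianTuple N n) := by
  have h1 : ∀ j : Fin n, Measurable fun x : (Fin n → Matrix (Fin N) (Fin N) ℂ) ×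
      (Fin n → Matrix (Fin N) (Fin N) ℂ) => x.1 j := fun j =>
    (measurable_pi_apply j).comp measurable_fst
  have h2 : ∀ j : Fin n, Measurable fun x : (Fin n → Matrix (Fin N) (Fin N) ℂ) ×
      (Fin n → Matrix (Fin N) (Fin N) ℂ) => x.2 j := fun j =>
    (measurable_pi_apply j).comp measurable_snd
  have hm : Measurable fun x : (Fin n → Matrix (Fin N) (Fin N) ℂ) ×
      (Fin n → Matrix (Fin N) (Fin N) ℂ) => ENNReal.ofReal (Ψ (fun j =>
        (tensorBar (x.1 j) (x.1 j) - tensorBar (x.2 j) (x.2 j)) * (1 - projId N)) ^ p) :=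
    measurable_seminorm_tuple Ψ p fun j => (((h1 j).tensorBar (h1 j)).matrix_sub
      ((h2 j).tensorBar (h2 j))).matrix_mul measurable_const
  have hm12 : Measurable fun x : (Fin n → Matrix (Fin N) (Fin N) ℂ) ×
      (Fin n → Matrix (Fin N) (Fin N) ℂ) =>
        ENNReal.ofReal (Ψ (fun j => tensorBar (x.1 j) (x.2 j)) ^ p) :=
    measurable_seminorm_tuple Ψ p fun j => (h1 j).tensorBar (h2 j)
  have hp0 : 0 ≤ p := by linarith
  have hrot : Measurable fun x : (Fin n → Matrix (Fin N) (Fin N) ℂ) ×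
      (Fin n → Matrix (Fin N) (Fin N) ℂ) => ((fun j => (rotatePair (x.1 j, x.2 j)).1 :
        Fin n → Matrix (Fin N) (Fin N) ℂ), (fun j => (rotatePair (x.1 j, x.2 j)).2 :
        Fin n → Matrix (Fin N) (Fin N) ℂ)) := by
    refine Measurable.prodMk (measurable_pi_lambda _ fun j => ?_)
      (measurable_pi_lambda _ fun j => ?_)
    · exact measurable_fst.comp (measurable_rotatePair.comp ((h1 j).prodMk (h2 j)))
    · exact measurable_snd.comp (measurable_rotatePair.comp ((h1 j).prodMk (h2 j)))
  conv_lhs => rw [gaussianTuple, ← map_rotatePair_pi]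
  rw [lintegral_map hm hrot]
  -- `I - P` is discarded by `hΨ`. Convexity of the power costs `2^(p-1)`, and the two terms have
  -- equal integrals by exchange of the copies, hence `2^p`.
  calc _ ≤ ∫⁻ x, 2 ^ (p - 1) * (ENNReal.ofReal (Ψ (fun j => tensorBar (x.1 j) (x.2 j)) ^ p) +
        ENNReal.ofReal (Ψ (fun j => tensorBar (x.2 j) (x.1 j)) ^ p))
          ∂(gaussianTuple N n).prod (gaussianTuple N n) := by
        refine lintegral_mono fun x => ?_
        refine le_trans (ENNReal.ofReal_le_ofReal (Real.rpow_le_rpow (apply_nonneg Ψ _) (hΨ _)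
          hp0)) ?_
        simp only [tensorBar_rotatePair]
        exact ofReal_rpow_seminorm_add_le Ψ hp _ _
    _ = 2 ^ (p - 1) * (∫⁻ x, ENNReal.ofReal (Ψ (fun j => tensorBar (x.1 j) (x.2 j)) ^ p)
          ∂(gaussianTuple N n).prod (gaussianTuple N n) +
        ∫⁻ x, ENNReal.ofReal (Ψ (fun j => tensorBar (x.2 j) (x.1 j)) ^ p)
          ∂(gaussianTuple N n).prod (gaussianTuple N n)) := by
        rw [lintegral_const_mul' _ _ (by finiteness), lintegral_add_left hm12]
    _ = 2 ^ (p - 1) * (2 * ∫⁻ x, ENNReal.ofReal (Ψ (fun j => tensorBar (x.1 j) (x.2 j)) ^ p)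
          ∂(gaussianTuple N n).prod (gaussianTuple N n)) := by
        have hsw : ∫⁻ x, ENNReal.ofReal (Ψ (fun j => tensorBar (x.2 j) (x.1 j)) ^ p)
          ∂(gaussianTuple N n).prod (gaussianTuple N n) =
            ∫⁻ x, ENNReal.ofReal (Ψ (fun j => tensorBar (x.1 j) (x.2 j)) ^ p)
          ∂(gaussianTuple N n).prod (gaussianTuple N n) :=
          (Measure.measurePreserving_swap (μ := gaussianTuple N n)
            (ν := gaussianTuple N n)).lintegral_comp hm12
        rw [hsw, two_mul]
    _ = _ := by
        rw [← mul_assoc]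
        congr 1
        have h3 := ENNReal.rpow_add (p - 1) 1 (two_ne_zero (α := ℝ≥0∞)) ENNReal.ofNat_ne_top
        rw [sub_add_cancel, ENNReal.rpow_one] at h3
        exact h3.symm

theorem lintegral_haar_le_gaussian (hp : 1 ≤ p)
    (hΨ : ∀ X, Ψ (fun j => X j * (1 - projId N)) ≤ Ψ X) :
    ∫⁻ u, ENNReal.ofReal (Ψ (fun j => tensorBar (u j : Matrix (Fin N) (Fin N) ℂ) (u j) *
        (1 - projId N)) ^ p) ∂haarTuple N n ≤
      (24 : ℝ≥0∞) ^ p * ∫⁻ x, ENNReal.ofReal (Ψ (fun j => tensorBar (x.1 j) (x.2 j)) ^ p)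
        ∂(gaussianTuple N n).prod (gaussianTuple N n) := by
  have hp0 : 0 ≤ p := by linarith
  obtain ⟨c, hc, h⟩ := exists_lintegral_unitary_le_cfcAbs hp N
  have h1 : ∀ u : Fin n → Matrix.unitaryGroup (Fin N) ℂ,
      ENNReal.ofReal (Ψ (fun j => tensorBar (u j : Matrix (Fin N) (Fin N) ℂ) (u j) *
        (1 - projId N)) ^ p) ≤ (12 : ℝ≥0∞) ^ p * ∫⁻ y, ENNReal.ofReal (Ψ (fun j =>
        tensorBar ((u j : Matrix (Fin N) (Fin N) ℂ) * CFC.abs (y j))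
          ((u j : Matrix (Fin N) (Fin N) ℂ) * CFC.abs (y j)) * (1 - projId N)) ^ p)
          ∂gaussianTuple N n := by
    intro u
    -- Since `12 ‖c‖ ≥ 1`, the factor `12 ^ p` removes the scalar `c` from the tuple.
    refine le_trans ?_ (mul_le_mul_right (h n Ψ u) _)
    have h12 : (12 : ℝ≥0∞) = ENNReal.ofReal 12 := by simp
    rw [h12, ENNReal.ofReal_rpow_of_nonneg (by norm_num) hp0,
      ← ENNReal.ofReal_mul (by positivity), ← Real.mul_rpow (by norm_num) (apply_nonneg Ψ _)]
    refine ENNReal.ofReal_le_ofReal (Real.rpow_le_rpow (apply_nonneg Ψ _) ?_ hp0)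
    have h2 := map_smul_eq_mul Ψ c (fun j => tensorBar (u j : Matrix (Fin N) (Fin N) ℂ) (u j) *
        (1 - projId N))
    change Ψ (fun j => c • (tensorBar (u j : Matrix (Fin N) (Fin N) ℂ) (u j) *
        (1 - projId N))) = _ at h2
    rw [h2]
    nlinarith [apply_nonneg Ψ (fun j => tensorBar (u j : Matrix (Fin N) (Fin N) ℂ) (u j) *
        (1 - projId N))]
  calc _ ≤ ∫⁻ u, (12 : ℝ≥0∞) ^ p * ∫⁻ y, ENNReal.ofReal (Ψ (fun j =>
        tensorBar ((u j : Matrix (Fin N) (Fin N) ℂ) * CFC.abs (y j))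
          ((u j : Matrix (Fin N) (Fin N) ℂ) * CFC.abs (y j)) * (1 - projId N)) ^ p)
          ∂gaussianTuple N n ∂haarTuple N n := lintegral_mono h1
    _ = (12 : ℝ≥0∞) ^ p *
        ∫⁻ y, ENNReal.ofReal (Ψ (fun j => tensorBar (y j) (y j) * (1 - projId N)) ^ p)
          ∂gaussianTuple N n := by
        rw [lintegral_const_mul' _ _ (by finiteness), lintegral_cfcAbs_eq_gaussian]
    _ ≤ (12 : ℝ≥0∞) ^ p * (2 ^ p * ∫⁻ x, ENNReal.ofReal (Ψ (fun j =>
        tensorBar (x.1 j) (x.2 j)) ^ p) ∂(gaussianTuple N n).prod (gaussianTuple N n)) := by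
        gcongr
        exact (lintegral_gaussian_le_symmetrized Ψ hp).trans
          (lintegral_symmetrized_le_decoupled Ψ hp hΨ)
    _ = _ := by
        rw [← mul_assoc, ← ENNReal.mul_rpow_of_nonneg _ _ hp0]
        norm_num

end Comparison

/-! ### From product measures to random variables on a probability space -/

section Transfer

variable {N n : ℕ} {Ω : Type*} [MeasurableSpace Ω] {μ : Measure Ω} [IsProbabilityMeasure μ]

theorem hasLaw_tuple {E : Type*} [MeasurableSpace E] {ν : Measure E} {X : Fin n → Ω → E}
    (hX : ∀ j, HasLaw (X j) ν μ) (h : iIndepFun X μ) :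
    HasLaw (fun ω j => X j ω) (Measure.pi fun _ : Fin n => ν) μ where
  aemeasurable := aemeasurable_pi_lambda _ fun j => (hX j).aemeasurable
  map_eq := by
    rw [(iIndepFun_iff_map_fun_eq_pi_map fun j => (hX j).aemeasurable).1 h]
    simp_rw [(hX _).map_eq]

theorem hasLaw_prod {E F : Type*} [MeasurableSpace E] [MeasurableSpace F] {ν : Measure E}
    {ν' : Measure F} {X : Ω → E} {Y : Ω → F} (hX : HasLaw X ν μ) (hY : HasLaw Y ν' μ)
    (h : IndepFun X Y μ) : HasLaw (fun ω => (X ω, Y ω)) (ν.prod ν') μ where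
  aemeasurable := hX.aemeasurable.prodMk hY.aemeasurable
  map_eq := by
    rw [(indepFun_iff_map_prod_eq_prod_map_map hX.aemeasurable hY.aemeasurable).1 h,
      hX.map_eq, hY.map_eq]

theorem lintegral_unitary_le_gaussian
    {U : Fin n → Ω → Matrix.unitaryGroup (Fin N) ℂ} {Y Y' : Fin n → Ω → Matrix (Fin N) (Fin N) ℂ}
    (hU : ∀ j, HasLaw (U j) (haarUnitary N) μ) (hUi : iIndepFun U μ)
    (hY : ∀ j, HasLaw (Y j) (gaussianMatrix N) μ) (hYi : iIndepFun Y μ)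
    (hY' : ∀ j, HasLaw (Y' j) (gaussianMatrix N) μ) (hYi' : iIndepFun Y' μ)
    (hYY' : IndepFun (fun ω j => Y j ω) (fun ω j => Y' j ω) μ) {p : ℝ} (hp : 1 ≤ p)
    (Ψ : Seminorm ℂ (Fin n → Matrix (Fin N × Fin N) (Fin N × Fin N) ℂ))
    (hΨ : ∀ X, Ψ (fun j => X j * (1 - projId N)) ≤ Ψ X) :
    ∫⁻ ω, ENNReal.ofReal (Ψ (fun j =>
        tensorBar (U j ω : Matrix (Fin N) (Fin N) ℂ) (U j ω) * (1 - projId N)) ^ p) ∂μ ≤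
      (24 : ℝ≥0∞) ^ p *
        ∫⁻ ω, ENNReal.ofReal (Ψ (fun j => tensorBar (Y j ω) (Y' j ω)) ^ p) ∂μ := by
  have h1 := hasLaw_tuple hU hUi
  have h2 := hasLaw_prod (hasLaw_tuple hY hYi) (hasLaw_tuple hY' hYi') hYY'
  have h3 := lintegral_haar_le_gaussian (N := N) (n := n) Ψ hp hΨ
  have m1 : Measurable fun u : Fin n → Matrix.unitaryGroup (Fin N) ℂ => ENNReal.ofReal
      (Ψ (fun j => tensorBar (u j : Matrix (Fin N) (Fin N) ℂ) (u j) * (1 - projId N)) ^ p) := by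
    refine measurable_seminorm_tuple Ψ p fun j => ?_
    have := measurable_subtype_coe.comp (measurable_pi_apply (X := fun _ : Fin n =>
      Matrix.unitaryGroup (Fin N) ℂ) j)
    exact (this.tensorBar this).matrix_mul measurable_const
  have m2 : Measurable fun x : (Fin n → Matrix (Fin N) (Fin N) ℂ) ×
      (Fin n → Matrix (Fin N) (Fin N) ℂ) =>
      ENNReal.ofReal (Ψ (fun j => tensorBar (x.1 j) (x.2 j)) ^ p) := by
    refine measurable_seminorm_tuple Ψ p fun j => ?_
    exact ((measurable_pi_apply j).comp measurable_fst).tensorBar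
      ((measurable_pi_apply j).comp measurable_snd)
  rw [← h1.lintegral_comp m1.aemeasurable, ← h2.lintegral_comp m2.aemeasurable] at h3
  exact h3

end Transfer

/-! ### Matrix coefficients and the main theorem -/

theorem isStarProjection_one_kronecker {l m : Type*} [Fintype l] [DecidableEq l] [Fintype m]
    [DecidableEq m] {Q : Matrix m m ℂ} (hQ : IsStarProjection Q) :
    IsStarProjection ((1 : Matrix l l ℂ) ⊗ₖ Q) where
  isIdempotentElem := by
    rw [IsIdempotentElem, ← Matrix.mul_kronecker_mul, one_mul, hQ.isIdempotentElem.eq]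
  isSelfAdjoint := by
    rw [IsSelfAdjoint, Matrix.star_eq_conjTranspose, Matrix.conjTranspose_kronecker,
      Matrix.conjTranspose_one, ← Matrix.star_eq_conjTranspose, hQ.isSelfAdjoint.star_eq]

/-- The linear map `X ↦ ∑ j, a j ⊗ X j`. -/
def kroneckerSum {n : ℕ} {l m : Type*} (a : Fin n → Matrix l l ℂ) :
    (Fin n → Matrix m m ℂ) →ₗ[ℂ] Matrix (l × m) (l × m) ℂ where
  toFun X := ∑ j, a j ⊗ₖ X j
  map_add' X Y := by simp [Matrix.kronecker_add, Finset.sum_add_distrib]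
  map_smul' c X := by simp [Matrix.kronecker_smul, Finset.smul_sum]

theorem kroneckerSum_apply {n : ℕ} {l m : Type*} (a : Fin n → Matrix l l ℂ)
    (X : Fin n → Matrix m m ℂ) : kroneckerSum a X = ∑ j, a j ⊗ₖ X j :=
  rfl

end RandomTensor

theorem mainTheorem1 :
    ∃ C : ℝ≥0, ∀ (N n : ℕ)
      {Ω : Type*} [MeasurableSpace Ω] (μ : Measure Ω) [IsProbabilityMeasure μ]
      (U : Fin n → Ω → Matrix.unitaryGroup (Fin N) ℂ)
      (Y Y' : Fin n → Ω → Matrix (Fin N) (Fin N) ℂ),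
      (∀ j, HasLaw (U j) (RandomTensor.haarUnitary N) μ) → iIndepFun U μ →
      (∀ j, HasLaw (Y j) (RandomTensor.gaussianMatrix N) μ) → iIndepFun Y μ →
      (∀ j, HasLaw (Y' j) (RandomTensor.gaussianMatrix N) μ) → iIndepFun Y' μ →
      IndepFun (fun ω j => Y j ω) (fun ω j => Y' j ω) μ →
      ∀ (p : ℝ) (q : ℝ≥0∞), 1 ≤ p → 1 ≤ q →
        (∀ a : Fin n → ℂ,
          ∫⁻ ω, ENNReal.ofReal (RandomTensor.schattenNorm q
              (∑ j, a j • (RandomTensor.tensorBar (U j ω : Matrix (Fin N) (Fin N) ℂ) (U j ω)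
                * (1 - RandomTensor.projId N))) ^ p) ∂μ
            ≤ (C : ℝ≥0∞) ^ p * ∫⁻ ω, ENNReal.ofReal (RandomTensor.schattenNorm q
              (∑ j, a j • RandomTensor.tensorBar (Y j ω) (Y' j ω)) ^ p) ∂μ) ∧
        (∀ (k : ℕ) (a : Fin n → Matrix (Fin k) (Fin k) ℂ),
          ∫⁻ ω, ENNReal.ofReal (RandomTensor.schattenNorm q
              (∑ j, a j ⊗ₖ (RandomTensor.tensorBar (U j ω : Matrix (Fin N) (Fin N) ℂ) (U j ω)
                * (1 - RandomTensor.projId N))) ^ p) ∂μ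
            ≤ (C : ℝ≥0∞) ^ p * ∫⁻ ω, ENNReal.ofReal (RandomTensor.schattenNorm q
              (∑ j, a j ⊗ₖ RandomTensor.tensorBar (Y j ω) (Y' j ω)) ^ p) ∂μ) := by
  refine ⟨24, fun N n Ω _ μ _ U Y Y' hU hUi hY hYi hY' hYi' hYY' p q hp hq => ⟨fun a => ?_,
    fun k a => ?_⟩⟩
  · have h := RandomTensor.lintegral_unitary_le_gaussian hU hUi hY hYi hY' hYi' hYY' hp
      ((RandomTensor.schattenSeminorm (Fin N × Fin N) q hq).comp
        (∑ j, a j • LinearMap.proj j)) fun X => by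
        have := RandomTensor.schattenNorm_mul_projection_le hq (∑ j, a j • X j)
          (RandomTensor.isStarProjection_projId N).one_sub
        simpa [RandomTensor.schattenSeminorm_apply, Finset.sum_mul] using this
    simpa [RandomTensor.schattenSeminorm_apply] using h
  · have h := RandomTensor.lintegral_unitary_le_gaussian hU hUi hY hYi hY' hYi' hYY' hp
      -- Multiplying every `X j` by `I - P` multiplies `∑ j, a j ⊗ X j` on the right by the
      -- projection `1 ⊗ (I - P)`, so this seminorm satisfies the contraction hypothesis for every
      -- `k`.
      ((RandomTensor.schattenSeminorm (Fin k × Fin N × Fin N) q hq).comp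
        (RandomTensor.kroneckerSum a)) fun X => by
        have := RandomTensor.schattenNorm_mul_projection_le hq (∑ j, a j ⊗ₖ X j)
          (RandomTensor.isStarProjection_one_kronecker (l := Fin k)
            (RandomTensor.isStarProjection_projId N).one_sub)
        simpa only [Seminorm.comp_apply, RandomTensor.kroneckerSum_apply,
          RandomTensor.schattenSeminorm_apply, Finset.sum_mul, ← Matrix.mul_kronecker_mul,
          mul_one] using this
    simpa only [Seminorm.comp_apply, RandomTensor.kroneckerSum_apply,
      RandomTensor.schattenSeminorm_apply, ENNReal.coe_ofNat] using h
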